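/- Let $K/k$ be an abelian extension of number fields which is unramified at all finite places and in which the archimedean places split completely (no real place of $k$ becomes complex in $K$). Suppose that $\mathrm{Gal}(K/k)$ is isomorphic to the direct product $C\times E$ of a cyclic group $C$ and an elementary cyclic group $E$, i.e. a cyclic group $E$ of squarefree order (so that every Sylow $p$-subgroup of $E$ is trivial or of order $p$). Let $\mathrm{Cap}_{K/k}$ be the kernel of the homomorphism $\mathrm{Cl}_k\to \mathrm{Cl}_K$ of ideal class groups induced by extension of ideals. Then $|\mathrm{Cap}_{K/k}|$ is a multiple of $[K:k]$. -/

import Mathlib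

open scoped NumberField

/-- The finite places of `K` are unramified over `k`: every nonzero prime ideal of the ring of
integers of `K` is unramified over the ring of integers of `k`. -/
def UnramifiedAtFinitePlaces (k K : Type*) [Field k] [NumberField k] [Field K] [NumberField K]
    [Algebra k K] : Prop :=
  ∀ (P : Ideal (𝓞 K)) [P.IsPrime], P ≠ ⊥ → Algebra.IsUnramifiedAt (𝓞 k) P

/-- The capitulation group of `K/k`: the ideal classes of `k` that become trivial in `K`, that is,
the kernel of the homomorphism `Cl_k → Cl_K` induced by extension of ideals. -/
noncomputable def Cap (k K : Type*) [Field k] [NumberField k] [Field K] [NumberField K]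
    [Algebra k K] : Subgroup (ClassGroup (𝓞 k)) :=
  (ClassGroup.extendedHom (𝓞 k) (𝓞 K)).ker

/-- An elementary cyclic group: a cyclic group of squarefree order, i.e. a finite cyclic group each
of whose Sylow `p`-subgroups is trivial or of order `p`. -/
structure IsElementaryCyclic (E : Type*) [Group E] : Prop where
  isCyclic : IsCyclic E
  squarefree_card : Squarefree (Nat.card E)

/-! Both sides are compared one prime p at a time. The subextension of K cut out by the p^a-th
powers in Gal(K/k), with p^a the p-part of [K:k], carries the whole p-part of [K:k], and its
capitulation group is a subgroup of Cap(K/k). So Gal(K/k) may be taken to be a p-group that is a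
quotient of C × E. The image of E then has order 1 or p; its fixed field L is cyclic over k, and
[K:L] divides p.

Let q = (E_k : N E_L) be the norm index of units, and let B be the group of classes in Cap(K/L) that
come from Cl_k. Three facts combine. (1) A sharp Hilbert 94: [L:k]·q divides |Cap(L/k)|. The
Herbrand quotient of the units gives |H⁻¹(E_L)| = [L:k]·q, and H⁻¹(E_L) is isomorphic to a
subquotient of Cap(L/k). (2) [K:L] divides the number of classes of Cap(K/L) fixed by Gal(L/k):
Hilbert 94 for K/L gives p | |Cap(K/L)| when [K:L] = p, and a p-group acting on it has a multiple of
p fixed points. (3) The fixed classes modulo B have order dividing q, so their number divides |B|·q.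
Since |Cap(K/k)| = |Cap(L/k)|·|B|, the surplus q in (1) pays for the loss q in (3), and [L:k]·[K:L]
divides |Cap(K/k)|.

The main lemmas are `relIndex_divSMulHom_integralUnits`,
`card_mul_relIndex_prodSMulHom_dvd_card_cap`, `card_fixedCap_dvd` and
`finrank_dvd_card_cap_of_tower`. -/

/-! ### Herbrand quotients and a sign lemma for matrices. -/

/-- The index of a subgroup splits along a homomorphism into the index of the images and the index
of the kernels. -/
theorem Subgroup.relIndex_map_mul_relIndex_inf_ker {X Y : Type*} [CommGroup X] [CommGroup Y]
    (f : X →* Y) {M' M : Subgroup X} (h : M' ≤ M) :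
    (M'.map f).relIndex (M.map f) * (M' ⊓ f.ker).relIndex (M ⊓ f.ker) = M'.relIndex M := by
  have h1 : (M'.map f).relIndex (M.map f) = (M' ⊔ (M ⊓ f.ker)).relIndex M := by
    rw [← Subgroup.relIndex_comap, Subgroup.comap_map_eq, ← Subgroup.inf_relIndex_right]
    congr 1
    rw [inf_comm M, sup_inf_assoc_of_le _ h]
  have h2 : (M' ⊓ f.ker).relIndex (M ⊓ f.ker) = M'.relIndex (M' ⊔ (M ⊓ f.ker)) := by
    rw [sup_comm, Subgroup.relIndex_sup_right, ← Subgroup.inf_relIndex_right M']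
    congr 1
    rw [← inf_assoc, inf_eq_left.2 h]
  rw [h1, h2, mul_comm]
  exact Subgroup.relIndex_mul_relIndex _ _ _ le_sup_left (sup_le h inf_le_left)

/-- The Herbrand quotient of a pair of endomorphisms `f`, `g` with `f ∘ g = g ∘ f = 1` is the same
for commensurable modules. -/
theorem Subgroup.herbrand_eq_of_relIndex_ne_zero {X : Type*} [CommGroup X] (f g : X →* X)
    (hfg : ∀ x, f (g x) = 1) (hgf : ∀ x, g (f x) = 1) {M' M : Subgroup X} (h : M' ≤ M)
    (hfM : M.map f ≤ M) (hgM : M.map g ≤ M) (hfM' : M'.map f ≤ M') (hgM' : M'.map g ≤ M')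
    (hfin : M'.relIndex M ≠ 0) :
    (M.map f).relIndex (M ⊓ g.ker) * (M'.map g).relIndex (M' ⊓ f.ker) =
      (M'.map f).relIndex (M' ⊓ g.ker) * (M.map g).relIndex (M ⊓ f.ker) := by
  -- The index of f(M') in M ∩ ker g, computed along the chains through f(M) and through M' ∩ ker g.
  have aux : ∀ (f g : X →* X), (∀ x, g (f x) = 1) → M.map f ≤ M → M'.map f ≤ M' →
      (M'.map f).relIndex (M.map f) * (M.map f).relIndex (M ⊓ g.ker) =
      (M'.map f).relIndex (M' ⊓ g.ker) * (M' ⊓ g.ker).relIndex (M ⊓ g.ker) := by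
    intro f g hgf hM hM'
    have hk : ∀ A : Subgroup X, A.map f ≤ g.ker := by
      rintro A _ ⟨x, -, rfl⟩
      exact hgf x
    rw [Subgroup.relIndex_mul_relIndex _ _ _ (Subgroup.map_mono h) (le_inf hM (hk M)),
      Subgroup.relIndex_mul_relIndex _ _ _ (le_inf hM' (hk M')) (inf_le_inf_right _ h)]
  have e1 := aux f g hgf hfM hfM'
  have e2 := aux g f hfg hgM hgM'
  have i1 := Subgroup.relIndex_map_mul_relIndex_inf_ker f h
  have i2 := Subgroup.relIndex_map_mul_relIndex_inf_ker g h
  have n1 := hfin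
  rw [← i1] at n1
  have n2 := hfin
  rw [← i2] at n2
  have key := i1.trans i2.symm
  obtain ⟨n1a, n1b⟩ := mul_ne_zero_iff.1 n1
  obtain ⟨n2a, n2b⟩ := mul_ne_zero_iff.1 n2
  apply Nat.eq_of_mul_eq_mul_left (Nat.pos_of_ne_zero n1)
  generalize (M'.map f).relIndex (M.map f) = a at *
  generalize (M' ⊓ f.ker).relIndex (M ⊓ f.ker) = b at *
  generalize (M'.map g).relIndex (M.map g) = c at *
  generalize (M' ⊓ g.ker).relIndex (M ⊓ g.ker) = d at *
  generalize (M.map f).relIndex (M ⊓ g.ker) = u at *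
  generalize (M'.map f).relIndex (M' ⊓ g.ker) = u' at *
  generalize (M.map g).relIndex (M ⊓ f.ker) = v at *
  generalize (M'.map g).relIndex (M' ⊓ f.ker) = v' at *
  calc a * b * (u * v') = (a * u) * (v' * b) := by ring
    _ = (u' * d) * (c * v) := by rw [e1, e2]
    _ = (c * d) * (u' * v) := by ring
    _ = a * b * (u' * v) := by rw [key]

/-- A vector in the left kernel of a real square matrix with negative off-diagonal entries and
vanishing row sums is positive as soon as one entry is positive. -/
theorem pos_of_sum_mul_eq_zero {S : Type*} [Fintype S] {A : S → S → ℝ}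
    (hA : ∀ w v, v ≠ w → A w v < 0) (hsum : ∀ w, ∑ v, A w v = 0) {n : S → ℝ}
    (hn : ∀ v, ∑ w, n w * A w v = 0) {w₀ : S} (h₀ : 0 < n w₀) (w : S) : 0 < n w := by
  classical
  by_contra hw
  -- Add up the relations for the columns in P. Row x contributes n x times its partial sum over P.
  -- That sum is positive for x in P (the omitted entries are negative, and w is omitted) and
  -- nonpositive otherwise, so the total cannot vanish.
  let P : Finset S := Finset.univ.filter (fun v => 0 < n v)
  have key : ∑ x, n x * ∑ v ∈ P, A x v = 0 := by
    simp_rw [Finset.mul_sum]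
    rw [Finset.sum_comm]
    exact Finset.sum_eq_zero fun v _ => hn v
  have hcompl : ∀ x, ∑ v ∈ P, A x v = -∑ v ∈ Pᶜ, A x v := by
    intro x
    rw [eq_neg_iff_add_eq_zero, Finset.sum_add_sum_compl, hsum]
  have hpos : ∀ x ∈ P, 0 < n x * ∑ v ∈ P, A x v := by
    intro x hx
    refine mul_pos (by simpa [P] using hx) ?_
    rw [hcompl, neg_pos]
    refine Finset.sum_neg (fun v hv => hA x v ?_) ⟨w, by simpa [P] using hw⟩
    rintro rfl
    exact (Finset.mem_compl.1 hv) hx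
  have hnonneg : ∀ x, 0 ≤ n x * ∑ v ∈ P, A x v := by
    intro x
    by_cases hx : x ∈ P
    · exact (hpos x hx).le
    · refine mul_nonneg_of_nonpos_of_nonpos (by simpa [P] using hx) ?_
      refine Finset.sum_nonpos fun v hv => (hA x v ?_).le
      rintro rfl
      exact hx hv
  have : 0 < ∑ x, n x * ∑ v ∈ P, A x v :=
    Finset.sum_pos' (fun x _ => hnonneg x) ⟨w₀, Finset.mem_univ _, hpos w₀ (by simpa [P] using h₀)⟩
  exact this.ne' key

/-- Otherwise n or -n has a positive entry and so only positive entries, contrary to n w₀ = 0. Thus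
relations between Minkowski units are determined by one exponent. -/
theorem eq_zero_of_sum_mul_eq_zero {S : Type*} [Fintype S] {A : S → S → ℝ}
    (hA : ∀ w v, v ≠ w → A w v < 0) (hsum : ∀ w, ∑ v, A w v = 0) {n : S → ℝ}
    (hn : ∀ v, ∑ w, n w * A w v = 0) {w₀ : S} (h₀ : n w₀ = 0) (w : S) : n w = 0 := by
  rcases lt_trichotomy (n w) 0 with h | h | h
  · have hn' : ∀ v, ∑ w, (-n w) * A w v = 0 := fun v => by
      simp_rw [neg_mul]; rw [Finset.sum_neg_distrib, hn, neg_zero]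
    have := pos_of_sum_mul_eq_zero hA hsum hn' (w₀ := w) (by linarith) w₀
    linarith
  · exact h
  · have := pos_of_sum_mul_eq_zero hA hsum hn h w₀
    linarith

theorem Finset.prod_zpow_eq_zpow_sum {ι X : Type*} [CommGroup X] (s : Finset ι) (f : ι → ℤ) (x : X) :
    ∏ i ∈ s, x ^ f i = x ^ ∑ i ∈ s, f i := by
  classical
  induction s using Finset.induction_on with
  | empty => simp
  | insert a s ha ih => rw [Finset.prod_insert ha, Finset.sum_insert ha, ih, zpow_add]

/-! ### Tate cohomology of ℤ[S]/ℤ for a free action of a cyclic group on S. -/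

section PermutationModule

variable {G S X : Type*} [Group G] [CommGroup X] [MulDistribMulAction G X]

/-- The endomorphism `x ↦ x / σ x`. -/
def divSMulHom (X : Type*) [CommGroup X] [MulDistribMulAction G X] (σ : G) : X →* X where
  toFun x := x / σ • x
  map_one' := by simp
  map_mul' x y := by rw [smul_mul', mul_div_mul_comm]

theorem divSMulHom_apply (σ : G) (x : X) : divSMulHom X σ x = x / σ • x := rfl

theorem mem_ker_divSMulHom {σ : G} {x : X} : x ∈ (divSMulHom X σ).ker ↔ σ • x = x := by
  rw [MonoidHom.mem_ker, divSMulHom_apply, div_eq_one, eq_comm]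

variable (G) in
/-- The norm endomorphism `x ↦ ∏ g, g x`. -/
def prodSMulHom (X : Type*) [CommGroup X] [MulDistribMulAction G X] [Fintype G] : X →* X where
  toFun x := ∏ g : G, g • x
  map_one' := by simp
  map_mul' x y := by simp [smul_mul', Finset.prod_mul_distrib]

theorem prodSMulHom_apply [Fintype G] (x : X) : prodSMulHom G X x = ∏ g : G, g • x := rfl

theorem smul_prodSMulHom [Fintype G] (h : G) (x : X) :
    h • prodSMulHom G X x = prodSMulHom G X x := by
  rw [prodSMulHom_apply, Finset.smul_prod']
  exact Fintype.prod_bijective (fun g => h * g) (Group.mulLeft_bijective h) _ _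
    fun g => by rw [mul_smul]

theorem prodSMulHom_smul [Fintype G] (h : G) (x : X) :
    prodSMulHom G X (h • x) = prodSMulHom G X x := by
  rw [prodSMulHom_apply, prodSMulHom_apply]
  exact Fintype.prod_bijective (fun g => g * h) (Group.mulRight_bijective h) _ _
    fun g => by rw [mul_smul]

theorem divSMulHom_prodSMulHom [Fintype G] (σ : G) (x : X) :
    divSMulHom X σ (prodSMulHom G X x) = 1 := by
  rw [divSMulHom_apply, smul_prodSMulHom, div_self']

theorem prodSMulHom_divSMulHom [Fintype G] (σ : G) (x : X) :
    prodSMulHom G X (divSMulHom X σ x) = 1 := by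
  rw [divSMulHom_apply, map_div, prodSMulHom_smul, div_self']

/-- The homomorphism from `ℤ^S` to a commutative group given by a family `η` indexed by `S`. -/
def zpowProdHom [Fintype S] (η : S → X) : Multiplicative (S → ℤ) →* X where
  toFun a := ∏ w, η w ^ (a.toAdd w)
  map_one' := by simp
  map_mul' a b := by simp [zpow_add, Finset.prod_mul_distrib]

variable [Fintype S]

theorem zpowProdHom_ofAdd (η : S → X) (a : S → ℤ) :
    zpowProdHom η (Multiplicative.ofAdd a) = ∏ w, η w ^ a w := rfl

theorem zpowProdHom_ofAdd_sub (η : S → X) (a b : S → ℤ) :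
    zpowProdHom η (Multiplicative.ofAdd (a - b)) =
      zpowProdHom η (Multiplicative.ofAdd a) / zpowProdHom η (Multiplicative.ofAdd b) := by
  rw [ofAdd_sub, map_div]

theorem apply_mem_range_zpowProdHom (η : S → X) (w : S) : η w ∈ (zpowProdHom η).range := by
  classical
  refine ⟨Multiplicative.ofAdd (Pi.single w 1), ?_⟩
  rw [zpowProdHom_ofAdd, Finset.prod_eq_single w]
  · simp
  · intro v _ hv; simp [hv]
  · simp

variable [MulAction G S]

theorem smul_zpowProdHom {η : S → X} (hη : ∀ (g : G) w, η (g • w) = g • η w) (g : G)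
    (a : S → ℤ) : g • zpowProdHom η (Multiplicative.ofAdd a) =
      zpowProdHom η (Multiplicative.ofAdd fun w => a (g⁻¹ • w)) := by
  rw [zpowProdHom_ofAdd, zpowProdHom_ofAdd, Finset.smul_prod']
  refine Fintype.prod_bijective (g • ·) (MulAction.bijective g) _ _ fun w => ?_
  rw [smul_zpow', hη, inv_smul_smul]

theorem prodSMulHom_zpowProdHom [Fintype G] {η : S → X}
    (hη : ∀ (g : G) w, η (g • w) = g • η w) (a : S → ℤ) :
    prodSMulHom G X (zpowProdHom η (Multiplicative.ofAdd a)) =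
      zpowProdHom η (Multiplicative.ofAdd fun w => ∑ g : G, a (g • w)) := by
  rw [prodSMulHom_apply]
  simp_rw [smul_zpowProdHom hη, zpowProdHom_ofAdd]
  rw [Finset.prod_comm]
  refine Finset.prod_congr rfl fun w _ => ?_
  rw [Finset.prod_zpow_eq_zpow_sum]
  congr 1
  exact Fintype.sum_equiv (Equiv.inv G) _ _ fun g => rfl

omit [Fintype S] in
/-- Representatives of the orbits of a free action. -/
theorem exists_orbit_representatives (hfree : ∀ (g : G) (w : S), g • w = w → g = 1) :
    ∃ (rep : S → S) (γ : S → G), (∀ (g : G) w, rep (g • w) = rep w) ∧ (∀ w, γ w • rep w = w) ∧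
      ∀ (g : G) w, γ (g • w) = g * γ w := by
  let rep : S → S := fun w => (Quotient.mk (MulAction.orbitRel G S) w).out
  have hrep : ∀ (g : G) w, rep (g • w) = rep w := by
    intro g w
    have : Quotient.mk (MulAction.orbitRel G S) (g • w) = Quotient.mk _ w :=
      Quotient.sound ⟨g, rfl⟩
    simp only [rep, this]
  have hγ : ∀ w, ∃ g : G, g • rep w = w := by
    intro w
    have : (MulAction.orbitRel G S) w (rep w) := (MulAction.orbitRel G S).symm (Quotient.mk_out w)
    exact this
  choose γ hγ using hγ
  refine ⟨rep, γ, hrep, hγ, fun g w => ?_⟩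
  have h1 : (γ (g • w)) • rep w = (g * γ w) • rep w := by
    rw [mul_smul, hγ, ← hrep g w, hγ]
  have h2 : ((g * γ w)⁻¹ * γ (g • w)) • rep w = rep w := by
    rw [mul_smul, h1, inv_smul_smul]
  exact (inv_mul_eq_one.1 (hfree _ _ h2)).symm

omit [Fintype S] in
/-- Summing over an orbit a function supported on the orbit representatives. -/
theorem sum_ite_eq_representative [Fintype G] [DecidableEq S]
    (hfree : ∀ (g : G) (w : S), g • w = w → g = 1) {rep : S → S} {γ : S → G}
    (hrep : ∀ (g : G) w, rep (g • w) = rep w) (hγ : ∀ w, γ w • rep w = w) (a : S → ℤ) (w : S) :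
    ∑ g : G, (if g • w = rep (g • w) then a (g • w) else 0) = a (rep w) := by
  have hw : (γ w)⁻¹ • w = rep w := by rw [inv_smul_eq_iff, hγ]
  rw [Finset.sum_eq_single (γ w)⁻¹]
  · have h2 : rep (rep w) = rep w := by rw [← hw, hrep]; exact hw.symm
    rw [hw, h2, if_pos rfl]
  · intro g _ hg
    refine if_neg fun h => hg ?_
    rw [hrep] at h
    have h3 : (g * γ w) • rep w = rep w := by rw [mul_smul, hγ]; exact h
    exact eq_inv_of_mul_eq_one_left (hfree _ _ h3)
  · simp

variable [Fintype G] {η : S → X} (hη : ∀ (g : G) w, η (g • w) = g • η w)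
  (hfree : ∀ (g : G) (w : S), g • w = w → g = 1)
  (hker : ∀ a : S → ℤ, ∏ w, η w ^ a w = 1 ↔ ∃ c, ∀ w, a w = c)
  {σ : G} (hσ : ∀ g, g ∈ Subgroup.zpowers σ)

include hη hfree hker hσ

/-- Vanishing of Ĥ⁰(ℤ[S]/ℤ). For a fixed element, the exponents a and their σ-translate differ by a
constant, which is 0 on summing over S. So a is constant on orbits, and is the norm of its
restriction to orbit representatives. -/
theorem range_zpowProdHom_inf_ker_divSMulHom_le :
    (zpowProdHom η).range ⊓ (divSMulHom X σ).ker ≤ (zpowProdHom η).range.map (prodSMulHom G X) := by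
  classical
  rintro _ ⟨⟨a, rfl⟩, ha⟩
  obtain ⟨a, rfl⟩ := Multiplicative.ofAdd.surjective a
  replace ha := mem_ker_divSMulHom.1 ha
  rw [smul_zpowProdHom hη, ← div_eq_one,
    ← zpowProdHom_ofAdd_sub, zpowProdHom_ofAdd, hker] at ha
  obtain ⟨c, hc⟩ := ha
  have hinv : ∀ w, a (σ⁻¹ • w) = a w := by
    intro w
    have hsum : ∑ v : S, ((fun w => a (σ⁻¹ • w)) - a) v = 0 := by
      simp only [Pi.sub_apply, Finset.sum_sub_distrib]
      rw [sub_eq_zero]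
      exact Fintype.sum_bijective (σ⁻¹ • ·) (MulAction.bijective σ⁻¹) _ _ fun v => rfl
    simp_rw [hc] at hsum
    rw [Finset.sum_const, smul_eq_zero, Finset.card_eq_zero] at hsum
    have hc0 : c = 0 := hsum.resolve_left (Finset.nonempty_iff_ne_empty.1 ⟨w, Finset.mem_univ w⟩)
    have := hc w
    rw [hc0, Pi.sub_apply, sub_eq_zero] at this
    exact this
  have hinv' : ∀ (g : G) w, a (g • w) = a w := by
    intro g
    let st : Subgroup G :=
      { carrier := {g | ∀ w, a (g • w) = a w}
        one_mem' := fun w => by rw [one_smul]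
        mul_mem' := fun {g h} hg hh w => by rw [mul_smul, hg, hh]
        inv_mem' := fun {g} hg w => by rw [← hg (g⁻¹ • w), smul_inv_smul] }
    have hmem : σ ∈ st := by
      rw [← inv_inv σ]
      exact st.inv_mem hinv
    exact (Subgroup.zpowers_le.2 hmem) (hσ g)
  obtain ⟨rep, γ, hrep, hγ, hγm⟩ := exists_orbit_representatives hfree
  let b : S → ℤ := fun w => if w = rep w then a w else 0
  refine ⟨_, ⟨Multiplicative.ofAdd b, rfl⟩, ?_⟩
  rw [prodSMulHom_zpowProdHom hη]
  congr 2
  funext w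
  rw [sum_ite_eq_representative hfree hrep hγ, ← hinv' (γ w), hγ]

/-- H⁻¹(ℤ[S]/ℤ) is cyclic of order |G|. Norm 1 means that all orbit sums of the exponents agree;
their common value modulo |G| is the invariant, since adding a constant d to the exponents changes
it by d·|G|. -/
theorem relIndex_map_divSMulHom_range_zpowProdHom [Nonempty S] :
    ((zpowProdHom η).range.map (divSMulHom X σ)).relIndex
      ((zpowProdHom η).range ⊓ (prodSMulHom G X).ker) = Fintype.card G := by
  classical
  obtain ⟨rep, γ, hrep, hγ, hγm⟩ := exists_orbit_representatives hfree
  obtain ⟨w₀⟩ := ‹Nonempty S›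
  let T : Subgroup (Multiplicative (S → ℤ)) := (prodSMulHom G X).ker.comap (zpowProdHom η)
  have hTmem : ∀ a : S → ℤ, Multiplicative.ofAdd a ∈ T ↔ ∃ c, ∀ w, ∑ g : G, a (g • w) = c := by
    intro a
    rw [Subgroup.mem_comap, MonoidHom.mem_ker, prodSMulHom_zpowProdHom hη, zpowProdHom_ofAdd, hker]
  have hT : (zpowProdHom η).range ⊓ (prodSMulHom G X).ker = T.map (zpowProdHom η) := by
    rw [Subgroup.map_comap_eq]
  let Ψ : Multiplicative (S → ℤ) →* Multiplicative (ZMod (Fintype.card G)) :=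
    AddMonoidHom.toMultiplicative
      { toFun := fun a => ((∑ g : G, a (g • w₀) : ℤ) : ZMod (Fintype.card G))
        map_zero' := by simp
        map_add' := fun a b => by simp [Finset.sum_add_distrib] }
  have hΨ : ∀ a : S → ℤ, Ψ (Multiplicative.ofAdd a) =
      Multiplicative.ofAdd ((∑ g : G, a (g • w₀) : ℤ) : ZMod (Fintype.card G)) := fun a => rfl
  have hΨker : ∀ a : S → ℤ, Multiplicative.ofAdd a ∈ Ψ.ker ↔
      (Fintype.card G : ℤ) ∣ ∑ g : G, a (g • w₀) := by
    intro a
    rw [MonoidHom.mem_ker, hΨ, ofAdd_eq_one, ZMod.intCast_zmod_eq_zero_iff_dvd]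
  have hdiv : ∀ (g : G) w, η (g • w) / η w ∈ (zpowProdHom η).range.map (divSMulHom X σ) := by
    intro g
    let st : Subgroup G :=
      { carrier := {g | ∀ w, η (g • w) / η w ∈ (zpowProdHom η).range.map (divSMulHom X σ)}
        one_mem' := fun w => by rw [one_smul, div_self']; exact one_mem _
        mul_mem' := fun {g h} hg hh w => by
          rw [← div_mul_div_cancel _ (η (h • w)), mul_smul]
          exact mul_mem (hg _) (hh _)
        inv_mem' := fun {g} hg w => by
          have := inv_mem (hg (g⁻¹ • w))
          rwa [smul_inv_smul, inv_div] at this }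
    have hmem : σ ∈ st := by
      intro w
      refine ⟨(η w)⁻¹, inv_mem (apply_mem_range_zpowProdHom η w), ?_⟩
      rw [divSMulHom_apply, smul_inv', ← hη, div_inv_eq_mul, mul_comm, div_eq_mul_inv]
    exact (Subgroup.zpowers_le.2 hmem) (hσ g)
  have hcomp : ((zpowProdHom η).range.map (divSMulHom X σ)).comap (zpowProdHom η) ⊓ T =
      Ψ.ker ⊓ T := by
    ext a
    obtain ⟨a, rfl⟩ := Multiplicative.ofAdd.surjective a
    simp only [Subgroup.mem_inf]
    refine and_congr_left fun haT => ?_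
    rw [hΨker]
    constructor
    · rintro ⟨_, ⟨b, rfl⟩, hb⟩
      obtain ⟨b, rfl⟩ := Multiplicative.ofAdd.surjective b
      rw [divSMulHom_apply, smul_zpowProdHom hη, ← zpowProdHom_ofAdd_sub, eq_comm, ← div_eq_one,
        ← zpowProdHom_ofAdd_sub, zpowProdHom_ofAdd, hker] at hb
      obtain ⟨c, hc⟩ := hb
      have : ∀ w, a w = b w - b (σ⁻¹ • w) + c := fun w => by
        have := hc w
        simp only [Pi.sub_apply] at this
        linarith
      simp_rw [this, Finset.sum_add_distrib, Finset.sum_sub_distrib]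
      have e : ∑ g : G, b (g • w₀) = ∑ g : G, b (σ⁻¹ • g • w₀) := by
        refine (Fintype.sum_bijective (fun g => σ⁻¹ * g) (Group.mulLeft_bijective _) _ _
          fun g => ?_).symm
        rw [mul_smul]
      rw [e, sub_self, zero_add, Finset.sum_const, nsmul_eq_mul, Finset.card_univ]
      exact dvd_mul_right _ _
    · intro hd
      obtain ⟨c, hc⟩ := (hTmem a).1 haT
      obtain ⟨d, hd⟩ := hd
      rw [hc] at hd
      -- Subtracting the constant d makes all orbit sums zero without changing the element.
      have hshift : zpowProdHom η (Multiplicative.ofAdd a) =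
          zpowProdHom η (Multiplicative.ofAdd (a - fun _ => d)) := by
        rw [zpowProdHom_ofAdd_sub, zpowProdHom_ofAdd (a := fun _ => d),
          (hker fun _ => d).2 ⟨d, fun _ => rfl⟩, div_one]
      rw [Subgroup.mem_comap, hshift, zpowProdHom_ofAdd]
      set a' : S → ℤ := a - fun _ => d with ha'
      have hsum : ∀ w, ∑ g : G, a' (g • w) = 0 := by
        intro w
        simp only [ha', Pi.sub_apply, Finset.sum_sub_distrib, hc, Finset.sum_const, nsmul_eq_mul,
          Finset.card_univ, hd, sub_self]
      -- The first factor lies in the image of 1 - σ by `hdiv`; the second collects to a power of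
      -- each representative, whose exponent is an orbit sum, hence 0.
      have hsplit : ∏ w, η w ^ a' w =
          (∏ w, (η w / η (rep w)) ^ a' w) * ∏ w, η (rep w) ^ a' w := by
        rw [← Finset.prod_mul_distrib]
        refine Finset.prod_congr rfl fun w _ => ?_
        rw [← mul_zpow, div_mul_cancel]
      have hone : ∏ w, η (rep w) ^ a' w = 1 := by
        rw [← Finset.prod_fiberwise (s := Finset.univ) (g := rep)]
        refine Finset.prod_eq_one fun r _ => ?_
        by_cases hr : ∃ w, rep w = r
        · obtain ⟨w, rfl⟩ := hr
          have hval : ∏ v with rep v = rep w, η (rep v) ^ a' v =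
              ∏ v with rep v = rep w, η (rep w) ^ a' v := by
            refine Finset.prod_congr rfl fun v hv => ?_
            rw [(Finset.mem_filter.1 hv).2]
          rw [hval, Finset.prod_zpow_eq_zpow_sum]
          have hz : ∑ v with rep v = rep w, a' v = ∑ g : G, a' (g • w) := by
            symm
            refine Finset.sum_bij (fun g _ => g • w) ?_ ?_ ?_ ?_
            · intro g _
              simp [hrep]
            · intro g _ h _ hgh
              have : (h⁻¹ * g) • w = w := by rw [mul_smul, inv_smul_eq_iff]; exact hgh
              exact (inv_mul_eq_one.1 (hfree _ _ this)).symm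
            · intro v hv
              have hv' : rep v = rep w := by simpa using hv
              refine ⟨γ v * (γ w)⁻¹, Finset.mem_univ _, ?_⟩
              have : (γ w)⁻¹ • w = rep w := by rw [inv_smul_eq_iff, hγ]
              rw [mul_smul, this, ← hv', hγ]
            · intro g _; rfl
          rw [hz, hsum, zpow_zero]
        · refine Finset.prod_eq_one fun v hv => ?_
          exact absurd ⟨v, (Finset.mem_filter.1 hv).2⟩ hr
      rw [hsplit, hone, mul_one]
      refine Subgroup.prod_mem _ fun w _ => Subgroup.zpow_mem _ ?_ _
      have := hdiv (γ w) (rep w)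
      rwa [hγ] at this
  rw [hT, ← Subgroup.relIndex_comap, ← Subgroup.inf_relIndex_right, hcomp,
    Subgroup.inf_relIndex_right, Subgroup.relIndex_ker]
  have htop : T.map Ψ = ⊤ := by
    rw [eq_top_iff]
    intro z _
    -- Every orbit sum of m·b equals m, so every residue is attained.
    let b : S → ℤ := fun w => if w = rep w then 1 else 0
    have hb : ∀ w, ∑ g : G, b (g • w) = 1 := by
      exact sum_ite_eq_representative hfree hrep hγ fun _ => 1
    obtain ⟨m, hm⟩ := ZMod.intCast_surjective (Multiplicative.toAdd z)
    refine ⟨Multiplicative.ofAdd (fun w => m * b w), (hTmem _).2 ⟨m, fun w => ?_⟩, ?_⟩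
    · rw [← Finset.mul_sum, hb, mul_one]
    · rw [hΨ, ← Finset.mul_sum, hb, mul_one, hm]
      rfl
  rw [htop, Subgroup.card_top, Nat.card_congr Multiplicative.toAdd, Nat.card_zmod]

end PermutationModule

theorem finite_of_fg_of_forall_zpow_eq_one {Q : Type*} [CommGroup Q] [Group.FG Q]
    (h : ∀ q : Q, ∃ n : ℤ, n ≠ 0 ∧ q ^ n = 1) : Finite Q :=
  CommGroup.finite_of_fg_isMulTorsion _ fun q => isOfFinOrder_iff_zpow_eq_one.2 (h q)

/-! ### Minkowski units and the Herbrand quotient of the unit group. -/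

section UnitTheorem

open NumberField NumberField.InfinitePlace

/-- The units of the ring of integers, as a subgroup of the multiplicative group of the field. -/
def integralUnits (L : Type*) [Field L] : Subgroup Lˣ :=
  (Units.map (algebraMap (𝓞 L) L).toMonoidHom).range

variable {k L : Type*} [Field k] [Field L] [Algebra k L]

theorem coe_mem_integralUnits (u : (𝓞 L)ˣ) :
    Units.map (algebraMap (𝓞 L) L).toMonoidHom u ∈ integralUnits L := ⟨u, rfl⟩

theorem smul_mem_integralUnits (g : Gal(L/k)) {x : Lˣ} (hx : x ∈ integralUnits L) :
    g • x ∈ integralUnits L := by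
  obtain ⟨u, rfl⟩ := hx
  exact ⟨Units.map (MulSemiringAction.toRingHom Gal(L/k) (𝓞 L) g).toMonoidHom u, by ext; rfl⟩

theorem prodSMulHom_mem_integralUnits [Fintype Gal(L/k)] {x : Lˣ} (hx : x ∈ integralUnits L) :
    prodSMulHom Gal(L/k) Lˣ x ∈ integralUnits L :=
  Subgroup.prod_mem _ fun g _ => smul_mem_integralUnits g hx

theorem divSMulHom_mem_integralUnits (g : Gal(L/k)) {x : Lˣ} (hx : x ∈ integralUnits L) :
    divSMulHom Lˣ g x ∈ integralUnits L :=
  div_mem hx (smul_mem_integralUnits g hx)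

/-- The logarithm of a nonzero element at an infinite place, normalised for the product formula. -/
noncomputable def logPlace (w : InfinitePlace L) (x : Lˣ) : ℝ := w.mult * Real.log (w x)

theorem logPlace_mul (w : InfinitePlace L) (x y : Lˣ) :
    logPlace w (x * y) = logPlace w x + logPlace w y := by
  rw [logPlace, Units.val_mul, map_mul, Real.log_mul (by simp) (by simp), mul_add]; rfl

theorem logPlace_one (w : InfinitePlace L) : logPlace w 1 = 0 := by simp [logPlace]

/-- `logPlace` as a homomorphism. -/
noncomputable def logPlaceHom (w : InfinitePlace L) : Lˣ →* Multiplicative ℝ where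
  toFun x := Multiplicative.ofAdd (logPlace w x)
  map_one' := by rw [logPlace_one]; rfl
  map_mul' x y := by rw [logPlace_mul]; rfl

theorem logPlace_prod_zpow {ι : Type*} (s : Finset ι) (w : InfinitePlace L) (η : ι → Lˣ)
    (a : ι → ℤ) : logPlace w (∏ i ∈ s, η i ^ a i) = ∑ i ∈ s, (a i : ℝ) * logPlace w (η i) := by
  have h := map_prod (logPlaceHom w) (fun i => η i ^ a i) s
  have h2 := congrArg Multiplicative.toAdd h
  rw [toAdd_prod] at h2
  refine Eq.trans h2 (Finset.sum_congr rfl fun i _ => ?_)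
  rw [map_zpow, toAdd_zpow, zsmul_eq_mul]
  rfl

theorem sum_logPlace_of_mem [NumberField L] {x : Lˣ} (hx : x ∈ integralUnits L) :
    ∑ w : InfinitePlace L, logPlace w x = 0 := by
  obtain ⟨u, rfl⟩ := hx
  exact Units.sum_mult_mul_log u

theorem logPlace_smul (g : Gal(L/k)) (w : InfinitePlace L) (x : Lˣ) :
    logPlace (g • w) (g • x) = logPlace w x := by
  have hm : (g • w).mult = w.mult := by
    have := isReal_smul_iff (σ := g) (w := w)
    simp only [mult]
    split_ifs <;> tauto
  rw [logPlace, logPlace, hm, InfinitePlace.smul_apply]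
  congr 3
  exact g.symm_apply_apply _

/-- Stabilizers of infinite places are trivial when there is no ramification; this supplies the free
action needed for the permutation module. -/
theorem eq_one_of_smul_infinitePlace_eq [IsUnramifiedAtInfinitePlaces k L]
    (g : Gal(L/k)) (w : InfinitePlace L) (h : g • w = w) : g = 1 := by
  have := (InfinitePlace.isUnramified k w).stabilizer_eq_bot
  rw [← Subgroup.mem_bot, ← this]
  exact h

variable [NumberField L]

/-- Minkowski units: a Galois-equivariant family of units indexed by the infinite places, each of
absolute value less than one at all but one place. -/
theorem exists_equivariant_units [IsUnramifiedAtInfinitePlaces k L] :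
    ∃ ε : InfinitePlace L → Lˣ, (∀ w, ε w ∈ integralUnits L) ∧
      (∀ (g : Gal(L/k)) w, ε (g • w) = g • ε w) ∧ ∀ w v, v ≠ w → logPlace v (ε w) < 0 := by
  obtain ⟨rep, γ, hrep, hγ, hγm⟩ := exists_orbit_representatives (G := Gal(L/k))
    (S := InfinitePlace L) eq_one_of_smul_infinitePlace_eq
  choose u hu using Units.dirichletUnitTheorem.exists_unit L
  refine ⟨fun w => γ w • Units.map (algebraMap (𝓞 L) L).toMonoidHom (u (rep w)),
    fun w => smul_mem_integralUnits _ (coe_mem_integralUnits _), fun g w => ?_, fun w v hv => ?_⟩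
  · dsimp only
    rw [hrep, hγm, mul_smul]
  · have h : (γ w)⁻¹ • v ≠ rep w := by
      intro h
      rw [inv_smul_eq_iff, hγ] at h
      exact hv h
    have h2 := logPlace_smul (γ w) ((γ w)⁻¹ • v)
      (Units.map (algebraMap (𝓞 L) L).toMonoidHom (u (rep w)))
    rw [smul_inv_smul] at h2
    rw [h2]
    exact mul_neg_of_pos_of_neg (by exact_mod_cast mult_pos) (hu _ _ h)

/-- Dirichlet's theorem: a family longer than the unit rank is ℤ-dependent. -/
theorem exists_zpow_relation {ι : Type*} [Fintype ι]
    (hι : Units.rank L < Fintype.card ι) {ε : ι → Lˣ} (hε : ∀ i, ε i ∈ integralUnits L) :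
    ∃ m : ι → ℤ, ∏ i, ε i ^ m i = 1 ∧ ∃ i, m i ≠ 0 := by
  choose u hu using hε
  have hdep : ¬ LinearIndependent ℤ (fun i => Additive.ofMul (u i)) := by
    intro h
    have := h.fintype_card_le_finrank
    rw [Units.finrank_eq] at this
    omega
  rw [Fintype.not_linearIndependent_iff] at hdep
  obtain ⟨m, hm, hne⟩ := hdep
  refine ⟨m, ?_, hne⟩
  have h : ∏ i, u i ^ m i = 1 := by
    have := congrArg Additive.toMul hm
    rwa [toMul_sum] at this
  have := congrArg (Units.map (algebraMap (𝓞 L) L).toMonoidHom) h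
  rw [map_one, map_prod] at this
  rw [← this]
  refine Finset.prod_congr rfl fun i _ => ?_
  rw [map_zpow, hu]

theorem rank_lt_card_infinitePlace : Units.rank L < Fintype.card (InfinitePlace L) := by
  have : 0 < Fintype.card (InfinitePlace L) := Fintype.card_pos
  rw [Units.rank]
  omega

theorem sum_mul_logPlace_eq_zero {ε : InfinitePlace L → Lˣ} {m : InfinitePlace L → ℤ}
    (h : ∏ i, ε i ^ m i = 1) (v : InfinitePlace L) :
    ∑ w, (m w : ℝ) * logPlace v (ε w) = 0 := by
  rw [← logPlace_prod_zpow, h, logPlace_one]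

/-- A Galois-equivariant family of units indexed by the infinite places whose only relations are
the multiples of `∏ w, η w = 1`. -/
theorem exists_equivariant_units_prod_eq_one [FiniteDimensional k L]
    [IsUnramifiedAtInfinitePlaces k L] :
    ∃ η : InfinitePlace L → Lˣ, (∀ w, η w ∈ integralUnits L) ∧
      (∀ (g : Gal(L/k)) w, η (g • w) = g • η w) ∧
      ∀ a : InfinitePlace L → ℤ, ∏ w, η w ^ a w = 1 ↔ ∃ c, ∀ w, a w = c := by
  classical
  have : Fintype Gal(L/k) := Fintype.ofFinite _
  obtain ⟨ε, hεmem, hεeq, hεneg⟩ := exists_equivariant_units (k := k) (L := L)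
  have hεsum : ∀ w, ∑ v, logPlace v (ε w) = 0 := fun w => sum_logPlace_of_mem (hεmem w)
  -- There are more places than the unit rank, so a nontrivial relation exists. Up to sign one
  -- exponent is positive, and the sign lemma, applied to the matrix of logarithms (zero row sums by
  -- the product formula), makes all of them positive.
  obtain ⟨m, hm, hpos⟩ : ∃ m : InfinitePlace L → ℤ, ∏ i, ε i ^ m i = 1 ∧ ∀ i, 0 < m i := by
    obtain ⟨m, hm, i, hi⟩ := exists_zpow_relation (rank_lt_card_infinitePlace (L := L)) hεmem
    rcases lt_or_gt_of_ne hi with h | h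
    · have hm' : ∏ i, ε i ^ (-m i) = 1 := by simp [hm]
      refine ⟨fun i => -m i, hm', fun j => ?_⟩
      have := pos_of_sum_mul_eq_zero (n := fun i => ((-m i : ℤ) : ℝ)) hεneg hεsum
        (sum_mul_logPlace_eq_zero hm') (w₀ := i) (by exact_mod_cast (by omega : 0 < -m i)) j
      exact_mod_cast this
    · refine ⟨m, hm, fun j => ?_⟩
      have := pos_of_sum_mul_eq_zero (n := fun i => (m i : ℝ)) hεneg hεsum
        (sum_mul_logPlace_eq_zero hm) (w₀ := i) (by exact_mod_cast h) j
      exact_mod_cast this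
  -- Averaging the exponents over the Galois group makes them invariant, so ε ^ n is still
  -- equivariant while its product is 1.
  let n : InfinitePlace L → ℤ := fun w => ∑ g : Gal(L/k), m (g • w)
  have hnpos : ∀ w, 0 < n w := fun w => Finset.sum_pos (fun g _ => hpos _) Finset.univ_nonempty
  have hninv : ∀ (g : Gal(L/k)) w, n (g • w) = n w := by
    intro g w
    refine Fintype.sum_bijective (fun h => h * g) (Group.mulRight_bijective g) _ _ fun h => ?_
    rw [mul_smul]
  have hnrel : ∏ w, ε w ^ n w = 1 := by
    have := prodSMulHom_zpowProdHom hεeq m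
    rw [zpowProdHom_ofAdd, hm, map_one, zpowProdHom_ofAdd] at this
    exact this.symm
  have hηneg : ∀ w v, v ≠ w → logPlace v (ε w ^ n w) < 0 := by
    intro w v hv
    have := logPlace_prod_zpow {w} v ε n
    rw [Finset.prod_singleton, Finset.sum_singleton] at this
    rw [this]
    exact mul_neg_of_pos_of_neg (by exact_mod_cast hnpos w) (hεneg w v hv)
  have hηmem : ∀ w, ε w ^ n w ∈ integralUnits L := fun w => Subgroup.zpow_mem _ (hεmem w) _
  refine ⟨fun w => ε w ^ n w, hηmem, fun g w => ?_, fun a => ⟨fun ha => ?_, ?_⟩⟩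
  · dsimp only
    rw [hninv, hεeq, smul_zpow']
  · obtain ⟨w₀⟩ := (inferInstance : Nonempty (InfinitePlace L))
    refine ⟨a w₀, fun w => ?_⟩
    have hrel : ∏ w, (ε w ^ n w) ^ (a w - a w₀) = 1 := by
      simp_rw [zpow_sub, Finset.prod_mul_distrib]
      rw [ha, one_mul, Finset.prod_inv_distrib, Finset.prod_zpow, hnrel, one_zpow, inv_one]
    have := eq_zero_of_sum_mul_eq_zero (n := fun w => ((a w - a w₀ : ℤ) : ℝ)) hηneg
      (fun w => sum_logPlace_of_mem (hηmem w)) (sum_mul_logPlace_eq_zero hrel) (w₀ := w₀)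
      (by simp) w
    have h2 : a w - a w₀ = 0 := by exact_mod_cast this
    omega
  · rintro ⟨c, hc⟩
    simp_rw [hc]
    rw [Finset.prod_zpow, hnrel, one_zpow]

/-- Put a unit x in place of one η w₀: the resulting family is dependent, and x has nonzero exponent
because a relation of the η with one zero exponent is trivial. So the quotient is torsion, and it is
finitely generated. -/
theorem relIndex_range_zpowProdHom_ne_zero {η : InfinitePlace L → Lˣ}
    (hmem : ∀ w, η w ∈ integralUnits L)
    (hker : ∀ a : InfinitePlace L → ℤ, ∏ w, η w ^ a w = 1 → ∃ c, ∀ w, a w = c) :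
    (zpowProdHom η).range.relIndex (integralUnits L) ≠ 0 := by
  classical
  have hfg : Group.FG (integralUnits L) := by
    have : Group.FG (𝓞 L)ˣ := Group.fg_iff_monoid_fg.2 inferInstance
    exact Group.fg_range _
  obtain ⟨w₀⟩ := (inferInstance : Nonempty (InfinitePlace L))
  have htors : ∀ x ∈ integralUnits L, ∃ n : ℤ, n ≠ 0 ∧ x ^ n ∈ (zpowProdHom η).range := by
    intro x hx
    let f : InfinitePlace L → Lˣ := fun w => if w = w₀ then x else η w
    have hf : ∀ w, f w ∈ integralUnits L := by
      intro w
      by_cases h : w = w₀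
      · simp only [f, if_pos h, hx]
      · simp only [f, if_neg h, hmem]
    obtain ⟨m, hm, i, hi⟩ := exists_zpow_relation (rank_lt_card_infinitePlace (L := L)) hf
    have hm2 : x ^ m w₀ * ∏ w ∈ Finset.univ.erase w₀, η w ^ m w = 1 := by
      rw [← Finset.mul_prod_erase _ _ (Finset.mem_univ w₀)] at hm
      rw [← hm]
      congr 1
      · simp [f]
      · refine Finset.prod_congr rfl fun w hw => ?_
        simp only [f, if_neg (Finset.ne_of_mem_erase hw)]
    refine ⟨m w₀, fun h0 => ?_, ?_⟩
    · rw [h0, zpow_zero, one_mul] at hm2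
      have : ∏ w, η w ^ m w = 1 := by
        rw [← Finset.mul_prod_erase _ _ (Finset.mem_univ w₀), h0, zpow_zero, one_mul, hm2]
      obtain ⟨c, hc⟩ := hker m this
      rw [hc, ← hc w₀] at hi
      exact hi h0
    · rw [eq_inv_of_mul_eq_one_left hm2]
      exact inv_mem (Subgroup.prod_mem _ fun w _ =>
        Subgroup.zpow_mem _ (apply_mem_range_zpowProdHom η w) _)
  have hQ : Finite (integralUnits L ⧸ (zpowProdHom η).range.subgroupOf (integralUnits L)) := by
    have hfg' : Group.FG
        (integralUnits L ⧸ (zpowProdHom η).range.subgroupOf (integralUnits L)) :=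
      inferInstance
    refine finite_of_fg_of_forall_zpow_eq_one fun q => ?_
    obtain ⟨x, rfl⟩ := QuotientGroup.mk_surjective q
    obtain ⟨n, hn, h⟩ := htors x x.2
    exact ⟨n, hn, (QuotientGroup.eq_one_iff (x ^ n)).2 h⟩
  exact Subgroup.index_ne_zero_of_finite

/-- The Herbrand quotient of the units of a cyclic extension that is unramified at infinity. -/
theorem relIndex_divSMulHom_integralUnits [FiniteDimensional k L] [Fintype Gal(L/k)]
    [IsUnramifiedAtInfinitePlaces k L] {σ : Gal(L/k)} (hσ : ∀ g, g ∈ Subgroup.zpowers σ) :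
    ((integralUnits L).map (divSMulHom Lˣ σ)).relIndex
        (integralUnits L ⊓ (prodSMulHom Gal(L/k) Lˣ).ker) =
      Fintype.card Gal(L/k) * ((integralUnits L).map (prodSMulHom Gal(L/k) Lˣ)).relIndex
        (integralUnits L ⊓ (divSMulHom Lˣ σ).ker) := by
  obtain ⟨η, hmem, heq, hker⟩ := exists_equivariant_units_prod_eq_one (k := k) (L := L)
  have hfree := eq_one_of_smul_infinitePlace_eq (k := k) (L := L)
  have hle : (zpowProdHom η).range ≤ integralUnits L := by
    rintro _ ⟨a, rfl⟩
    exact Subgroup.prod_mem _ fun w _ => Subgroup.zpow_mem _ (hmem w) _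
  have hsmul : ∀ (g : Gal(L/k)), ∀ x ∈ (zpowProdHom η).range, g • x ∈ (zpowProdHom η).range := by
    rintro g _ ⟨a, rfl⟩
    obtain ⟨a, rfl⟩ := Multiplicative.ofAdd.surjective a
    rw [smul_zpowProdHom heq]
    exact ⟨_, rfl⟩
  have key := Subgroup.herbrand_eq_of_relIndex_ne_zero (divSMulHom Lˣ σ) (prodSMulHom Gal(L/k) Lˣ)
    (divSMulHom_prodSMulHom σ) (prodSMulHom_divSMulHom σ) hle
    (by rintro _ ⟨x, hx, rfl⟩; exact divSMulHom_mem_integralUnits σ hx)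
    (by rintro _ ⟨x, hx, rfl⟩; exact prodSMulHom_mem_integralUnits hx)
    (by rintro _ ⟨x, hx, rfl⟩; exact div_mem hx (hsmul σ x hx))
    (by rintro _ ⟨x, hx, rfl⟩; exact Subgroup.prod_mem _ fun g _ => hsmul g x hx)
    (relIndex_range_zpowProdHom_ne_zero hmem fun a => (hker a).1)
  rwa [relIndex_map_divSMulHom_range_zpowProdHom heq hfree hker hσ,
    Subgroup.relIndex_eq_one.2 (range_zpowProdHom_inf_ker_divSMulHom_le heq hfree hker hσ),
    mul_one] at key

end UnitTheorem

/-! ### Galois-stable ideals in unramified extensions. -/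

section Descent

open NumberField nonZeroDivisors
open scoped Pointwise

variable {k L : Type*} [Field k] [Field L] [Algebra k L]

theorem smul_map_algebraMap (g : Gal(L/k)) (I : Ideal (𝓞 k)) :
    g • I.map (algebraMap (𝓞 k) (𝓞 L)) = I.map (algebraMap (𝓞 k) (𝓞 L)) := by
  rw [Ideal.pointwise_smul_def, Ideal.map_map]
  congr 1
  ext x
  exact g.commutes x

variable [NumberField k] [NumberField L]

/-- In a Galois extension that is unramified at the finite places, Galois-stable ideals are
extended from the base. -/
theorem exists_map_eq_of_forall_smul_eq [IsGalois k L] (hunr : UnramifiedAtFinitePlaces k L)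
    (J : Ideal (𝓞 L)) (hJ : J ≠ ⊥) (hinv : ∀ g : Gal(L/k), g • J = J) :
    ∃ I : Ideal (𝓞 k), I.map (algebraMap (𝓞 k) (𝓞 L)) = J := by
  induction J using IsNoetherian.induction with
  | _ J ih =>
  by_cases htop : J = ⊤
  · exact ⟨⊤, by rw [htop, Ideal.map_top]⟩
  obtain ⟨P, hPmax, hJP⟩ := Ideal.exists_le_maximal J htop
  have hPbot : P ≠ ⊥ := fun h => hJ (le_bot_iff.1 (h ▸ hJP))
  set p : Ideal (𝓞 k) := P.under (𝓞 k) with hp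
  have hpmax : p.IsMaximal := Ideal.IsMaximal.under (𝓞 k) P
  have hpbot : p ≠ ⊥ := by
    intro h
    exact hPbot (Ideal.eq_bot_of_comap_eq_bot h)
  have hPp : P.LiesOver p := ⟨rfl⟩
  -- Without ramification p𝓞_L is the product of the distinct primes above p. They are conjugates of
  -- P, so all of them contain the stable ideal J.
  have hdvd : p.map (algebraMap (𝓞 k) (𝓞 L)) ∣ J := by
    rw [Ideal.map_algebraMap_eq_finsetProd_pow hpbot]
    have hmem : ∀ Q ∈ (p.primesOver (𝓞 L)).toFinset, Q.IsPrime ∧ Q.LiesOver p := by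
      intro Q hQ
      have h : Q ∈ p.primesOver (𝓞 L) := Set.mem_toFinset.1 hQ
      exact h
    have hQbot : ∀ Q ∈ (p.primesOver (𝓞 L)).toFinset, Q ≠ ⊥ := by
      intro Q hQ
      obtain ⟨h1, h2⟩ := hmem Q hQ
      exact Ideal.ne_bot_of_liesOver_of_ne_bot hpbot Q
    have he : ∀ Q ∈ (p.primesOver (𝓞 L)).toFinset, Q ^ Q.ramificationIdx (𝓞 k) = Q := by
      intro Q hQ
      obtain ⟨h1, h2⟩ := hmem Q hQ
      have := hunr Q (hQbot Q hQ)
      rw [Ideal.ramificationIdx_eq_one_of_isUnramifiedAt, pow_one]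
    rw [Finset.prod_congr rfl he]
    refine Finset.prod_dvd_of_coprime ?_ ?_
    · intro Q hQ Q' hQ' hne
      have hQm : Q.IsMaximal := (hmem Q hQ).1.isMaximal (hQbot Q hQ)
      have hQm' : Q'.IsMaximal := (hmem Q' hQ').1.isMaximal (hQbot Q' hQ')
      exact Ideal.isCoprime_iff_sup_eq.2 (hQm.coprime_of_ne hQm' hne)
    · intro Q hQ
      obtain ⟨h1, h2⟩ := hmem Q hQ
      obtain ⟨g, rfl⟩ := Ideal.exists_smul_eq_of_isGaloisGroup p P Q Gal(L/k)
      rw [Ideal.dvd_iff_le, ← hinv g]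
      exact Ideal.pointwise_smul_le_pointwise_smul_iff.2 hJP
  obtain ⟨J', hJ'⟩ := hdvd
  have hmap0 : p.map (algebraMap (𝓞 k) (𝓞 L)) ≠ 0 := fun h => hJ (by rw [hJ', h, zero_mul]; rfl)
  have hJ'0 : J' ≠ ⊥ := fun h => hJ (by rw [hJ', h, Ideal.mul_bot])
  have hlt : J' > J := by
    refine lt_of_le_of_ne (by rw [hJ']; exact Ideal.mul_le_right) ?_
    intro h
    have h1 : p.map (algebraMap (𝓞 k) (𝓞 L)) * J' = 1 * J' := by rw [← hJ', h, one_mul]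
    have h2 := mul_right_cancel₀ hJ'0 h1
    have h3 : p.map (algebraMap (𝓞 k) (𝓞 L)) ≤ P := Ideal.map_le_iff_le_comap.2 le_rfl
    rw [h2, Ideal.one_eq_top, top_le_iff] at h3
    exact hPmax.ne_top h3
  obtain ⟨I', hI'⟩ := ih J' hlt hJ'0 fun g => by
    have := hinv g
    rw [hJ', smul_mul', smul_map_algebraMap] at this
    exact mul_left_cancel₀ hmap0 this
  exact ⟨p * I', by rw [Ideal.map_mul, hI', ← hJ']⟩

end Descent

/-! ### Galois action and extension on fractional ideals. -/

section FractionalIdeals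

open NumberField nonZeroDivisors
open scoped Pointwise

/-- The group of fractional ideals of a number field. -/
abbrev FracIdeals (L : Type*) [Field L] [NumberField L] := (FractionalIdeal (𝓞 L)⁰ L)ˣ

variable {k L K : Type*} [Field k] [NumberField k] [Field L] [NumberField L] [Algebra k L]
  [Field K] [NumberField K] [Algebra k K] [Algebra L K] [IsScalarTower k L K]

/-- Clearing denominators, principal and integral ideals together generate the group. The
compatibilities below are checked on these generators. -/
theorem FracIdeals.hom_ext {X : Type*} [Group X] {f g : FracIdeals L →* X}
    (h1 : ∀ x, f (toPrincipalIdeal (𝓞 L) L x) = g (toPrincipalIdeal (𝓞 L) L x))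
    (h2 : ∀ J, f (FractionalIdeal.mk0 L J) = g (FractionalIdeal.mk0 L J)) : f = g := by
  ext I
  obtain ⟨a, J, ha, hI⟩ := FractionalIdeal.exists_eq_spanSingleton_mul (I : FractionalIdeal (𝓞 L)⁰ L)
  have ha' : ((algebraMap (𝓞 L) L a)⁻¹ : L) ≠ 0 := inv_ne_zero (RingOfIntegers.coe_ne_zero_iff.2 ha)
  have hJ : J ≠ 0 := by
    rintro rfl
    exact I.ne_zero (by rw [hI]; simp)
  have : I = toPrincipalIdeal (𝓞 L) L (Units.mk0 _ ha') *
      FractionalIdeal.mk0 L ⟨J, mem_nonZeroDivisors_iff_ne_zero.2 hJ⟩ := by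
    ext1
    rw [Units.val_mul, coe_toPrincipalIdeal, FractionalIdeal.coe_mk0, hI]
    rfl
  rw [this, map_mul, map_mul, h1, h2]

omit [NumberField k] [NumberField L] in
theorem le_comap_nonZeroDivisors (g : Gal(L/k)) :
    (𝓞 L)⁰ ≤ (𝓞 L)⁰.comap (MulSemiringAction.toRingHom Gal(L/k) (𝓞 L) g) :=
  nonZeroDivisors_le_comap_nonZeroDivisors_of_injective _ (MulAction.injective g)

/-- The action of the Galois group on fractional ideals. -/
noncomputable def galFracIdeals (g : Gal(L/k)) : FracIdeals L →* FracIdeals L :=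
  Units.map (FractionalIdeal.extendedHom' L (le_comap_nonZeroDivisors g)).toMonoidHom

theorem galFracIdeals_toPrincipalIdeal (g : Gal(L/k)) (x : Lˣ) :
    galFracIdeals g (toPrincipalIdeal (𝓞 L) L x) = toPrincipalIdeal (𝓞 L) L (g • x) := by
  ext1
  have h : IsLocalization.map L (MulSemiringAction.toRingHom Gal(L/k) (𝓞 L) g)
      (le_comap_nonZeroDivisors g) = (g : L →+* L) := by
    refine IsLocalization.ringHom_ext (𝓞 L)⁰ ?_
    rw [IsLocalization.map_comp]
    ext x
    rfl
  rw [galFracIdeals, Units.coe_map, coe_toPrincipalIdeal, coe_toPrincipalIdeal]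
  refine (FractionalIdeal.extended_spanSingleton L (le_comap_nonZeroDivisors g) (x : L)).trans ?_
  rw [h]
  rfl

omit [NumberField k] [NumberField L] in
theorem smul_mem_nonZeroDivisors (g : Gal(L/k)) (J : (Ideal (𝓞 L))⁰) :
    g • (J : Ideal (𝓞 L)) ∈ (Ideal (𝓞 L))⁰ := by
  have := mem_nonZeroDivisors_iff_ne_zero.1 J.2
  refine mem_nonZeroDivisors_iff_ne_zero.2 fun h => this ?_
  rw [← inv_smul_smul g (J : Ideal (𝓞 L)), h]
  exact Ideal.smul_bot _

theorem galFracIdeals_mk0 (g : Gal(L/k)) (J : (Ideal (𝓞 L))⁰) :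
    galFracIdeals g (FractionalIdeal.mk0 L J) =
      FractionalIdeal.mk0 L ⟨g • (J : Ideal (𝓞 L)), smul_mem_nonZeroDivisors g J⟩ := by
  ext1
  exact FractionalIdeal.extended_coeIdeal_eq_map L (le_comap_nonZeroDivisors g) (J : Ideal (𝓞 L))

noncomputable instance : MulDistribMulAction Gal(L/k) (FracIdeals L) where
  smul g := galFracIdeals g
  one_smul J := by
    refine DFunLike.congr_fun (f := galFracIdeals (1 : Gal(L/k))) (g := MonoidHom.id _)
      (FracIdeals.hom_ext (fun x => ?_) fun J => ?_) J
    · rw [galFracIdeals_toPrincipalIdeal, one_smul]; rfl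
    · rw [galFracIdeals_mk0]
      simp only [one_smul]
      rfl
  mul_smul g h J := by
    refine DFunLike.congr_fun (f := galFracIdeals (g * h))
      (g := (galFracIdeals g).comp (galFracIdeals h))
      (FracIdeals.hom_ext (fun x => ?_) fun J => ?_) J
    · simp only [MonoidHom.comp_apply, galFracIdeals_toPrincipalIdeal, mul_smul]
    · simp only [MonoidHom.comp_apply, galFracIdeals_mk0, mul_smul]
  smul_one g := map_one (galFracIdeals g)
  smul_mul g := map_mul (galFracIdeals g)

theorem smul_toPrincipalIdeal (g : Gal(L/k)) (x : Lˣ) :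
    g • toPrincipalIdeal (𝓞 L) L x = toPrincipalIdeal (𝓞 L) L (g • x) :=
  galFracIdeals_toPrincipalIdeal g x

theorem smul_mk0 (g : Gal(L/k)) (J : (Ideal (𝓞 L))⁰) :
    g • FractionalIdeal.mk0 L J =
      FractionalIdeal.mk0 L ⟨g • (J : Ideal (𝓞 L)), smul_mem_nonZeroDivisors g J⟩ :=
  galFracIdeals_mk0 g J

variable (k L) in
/-- Extension of fractional ideals. -/
noncomputable def extFracIdeals : FracIdeals k →* FracIdeals L :=
  Units.map (FractionalIdeal.extendedHom L (𝓞 L)).toMonoidHom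

theorem extFracIdeals_toPrincipalIdeal (x : kˣ) :
    extFracIdeals k L (toPrincipalIdeal (𝓞 k) k x) =
      toPrincipalIdeal (𝓞 L) L (Units.map (algebraMap k L).toMonoidHom x) := by
  ext1
  have h : IsFractionRing.map (K := k) (L := L)
      (FaithfulSMul.algebraMap_injective (𝓞 k) (𝓞 L)) = algebraMap k L := by
    refine IsLocalization.ringHom_ext (𝓞 k)⁰ ?_
    ext x
    rw [RingHom.comp_apply, IsFractionRing.map, IsLocalization.map_eq]
    rfl
  rw [extFracIdeals, Units.coe_map, coe_toPrincipalIdeal, coe_toPrincipalIdeal]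
  refine (FractionalIdeal.extendedHom_spanSingleton L (𝓞 L) (x : k)).trans ?_
  rw [h]
  rfl

theorem extFracIdeals_mk0 (I : (Ideal (𝓞 k))⁰) :
    extFracIdeals k L (FractionalIdeal.mk0 k I) =
      FractionalIdeal.mk0 L (ClassGroup.extendedIdeal (𝓞 k) (𝓞 L) I) := by
  ext1
  exact FractionalIdeal.extendedHom_coeIdeal_eq_map L (𝓞 L) (I : Ideal (𝓞 k))

theorem smul_extFracIdeals (g : Gal(L/k)) (I : FracIdeals k) :
    g • extFracIdeals k L I = extFracIdeals k L I := by
  refine DFunLike.congr_fun (f := (galFracIdeals g).comp (extFracIdeals k L))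
    (g := extFracIdeals k L) (FracIdeals.hom_ext (fun x => ?_) fun J => ?_) I
  · simp only [MonoidHom.comp_apply, extFracIdeals_toPrincipalIdeal, galFracIdeals_toPrincipalIdeal]
    congr 1
    ext
    exact g.commutes _
  · simp only [MonoidHom.comp_apply, extFracIdeals_mk0, galFracIdeals_mk0]
    congr 2
    exact smul_map_algebraMap g _

omit [IsScalarTower k L K] in
theorem extFracIdeals_smul (g : Gal(L/k)) (h : Gal(K/k))
    (hgh : ∀ x : L, h (algebraMap L K x) = algebraMap L K (g x)) (I : FracIdeals L) :
    extFracIdeals L K (g • I) = h • extFracIdeals L K I := by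
  refine DFunLike.congr_fun (f := (extFracIdeals L K).comp (galFracIdeals g))
    (g := (galFracIdeals h).comp (extFracIdeals L K))
    (FracIdeals.hom_ext (fun x => ?_) fun J => ?_) I
  · simp only [MonoidHom.comp_apply, extFracIdeals_toPrincipalIdeal, galFracIdeals_toPrincipalIdeal]
    congr 1
    ext
    exact (hgh _).symm
  · simp only [MonoidHom.comp_apply, extFracIdeals_mk0, galFracIdeals_mk0]
    refine congrArg _ (Subtype.ext ?_)
    have e : (algebraMap (𝓞 L) (𝓞 K)).comp (MulSemiringAction.toRingHom Gal(L/k) (𝓞 L) g) =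
        (MulSemiringAction.toRingHom Gal(K/k) (𝓞 K) h).comp (algebraMap (𝓞 L) (𝓞 K)) := by
      ext x
      exact (hgh _).symm
    refine (Ideal.map_map _ _).trans (Eq.trans ?_ (Ideal.map_map _ _).symm)
    exact congrArg (fun f => Ideal.map f (J : Ideal (𝓞 L))) e

theorem mk_toPrincipalIdeal (x : Lˣ) : ClassGroup.mk L (toPrincipalIdeal (𝓞 L) L x) = 1 := by
  rw [ClassGroup.mk_eq_one_iff, coe_toPrincipalIdeal]
  exact ⟨⟨x, FractionalIdeal.coe_spanSingleton _ _⟩⟩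

theorem mk_extFracIdeals (I : FracIdeals k) :
    ClassGroup.mk L (extFracIdeals k L I) =
      ClassGroup.extendedHom (𝓞 k) (𝓞 L) (ClassGroup.mk k I) := by
  have key : (ClassGroup.mk L).comp (extFracIdeals k L) =
      (ClassGroup.extendedHom (𝓞 k) (𝓞 L)).comp (ClassGroup.mk k) := by
    refine FracIdeals.hom_ext (fun x => ?_) fun J => ?_
    · rw [MonoidHom.comp_apply, MonoidHom.comp_apply, extFracIdeals_toPrincipalIdeal,
        mk_toPrincipalIdeal, mk_toPrincipalIdeal, map_one]
    · rw [MonoidHom.comp_apply, MonoidHom.comp_apply, extFracIdeals_mk0, ClassGroup.mk_mk0,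
        ClassGroup.mk_mk0, ClassGroup.extendedHom_mk0]
  exact DFunLike.congr_fun key I

end FractionalIdeals

/-! ### Hilbert's Theorems 90 and 94. -/

section Capitulation

open NumberField nonZeroDivisors
open scoped Pointwise

variable {k L : Type*} [Field k] [NumberField k] [Field L] [NumberField L] [Algebra k L]

theorem toPrincipalIdeal_eq_one_iff_mem_integralUnits {x : Lˣ} :
    toPrincipalIdeal (𝓞 L) L x = 1 ↔ x ∈ integralUnits L := by
  constructor
  · have aux : ∀ y : Lˣ, toPrincipalIdeal (𝓞 L) L y = 1 → ∃ z : 𝓞 L, (z : L) = y := by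
      intro y hy
      have h1 : FractionalIdeal.spanSingleton (𝓞 L)⁰ (y : L) = 1 := by
        rw [← coe_toPrincipalIdeal, hy, Units.val_one]
      have h2 := FractionalIdeal.mem_spanSingleton_self (𝓞 L)⁰ (y : L)
      rw [h1, FractionalIdeal.mem_one_iff] at h2
      exact h2
    intro hx
    obtain ⟨a, ha⟩ := aux x hx
    obtain ⟨b, hb⟩ := aux x⁻¹ (by rw [map_inv, hx, inv_one])
    have hab : a * b = 1 := by
      apply RingOfIntegers.coe_injective
      rw [map_mul, map_one]
      change (a : L) * (b : L) = 1
      rw [ha, hb, Units.mul_inv]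
    exact ⟨Units.mkOfMulEqOne a b hab, by ext; exact ha⟩
  · rintro ⟨u, rfl⟩
    ext1
    rw [coe_toPrincipalIdeal, Units.val_one]
    change FractionalIdeal.spanSingleton (𝓞 L)⁰ (algebraMap (𝓞 L) L u) = 1
    rw [← FractionalIdeal.coeIdeal_span_singleton, Ideal.span_singleton_eq_top.2 u.isUnit,
      FractionalIdeal.coeIdeal_top]

theorem mk_eq_one_iff_exists_toPrincipalIdeal_eq {I : FracIdeals L} :
    ClassGroup.mk L I = 1 ↔ ∃ x, toPrincipalIdeal (𝓞 L) L x = I := by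
  constructor
  · intro h
    rw [ClassGroup.mk_eq_one_iff] at h
    exact (mem_principal_ideals_iff (R := 𝓞 L)).2 (by
      obtain ⟨⟨x, hx⟩⟩ := h
      refine ⟨x, FractionalIdeal.coeToSubmodule_injective ?_⟩
      exact (FractionalIdeal.coe_spanSingleton _ _).trans hx.symm)
  · rintro ⟨x, rfl⟩
    exact mk_toPrincipalIdeal x

theorem mk_surjective : Function.Surjective (ClassGroup.mk L : FracIdeals L →* ClassGroup (𝓞 L)) := by
  intro c
  obtain ⟨J, rfl⟩ := ClassGroup.mk0_surjective c
  exact ⟨_, ClassGroup.mk_mk0 L J⟩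

-- A denominator d of J has a nonzero multiple m in 𝓞 k. Being fixed by the Galois group, m
-- preserves the stability of J.
omit [NumberField k] in
theorem exists_toPrincipalIdeal_mul_eq_mk0 (J : FracIdeals L) :
    ∃ m : kˣ, ∃ J₀ : (Ideal (𝓞 L))⁰, toPrincipalIdeal (𝓞 L) L
      (Units.map (algebraMap k L).toMonoidHom m) * J = FractionalIdeal.mk0 L J₀ := by
  obtain ⟨d, J₀, hd, hJ⟩ :=
    FractionalIdeal.exists_eq_spanSingleton_mul (J : FractionalIdeal (𝓞 L)⁰ L)
  have hbot : (Ideal.span {d}).comap (algebraMap (𝓞 k) (𝓞 L)) ≠ ⊥ := fun h =>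
    hd (Ideal.span_singleton_eq_bot.1 (Ideal.eq_bot_of_comap_eq_bot h))
  obtain ⟨m, hm, hm0⟩ := Submodule.exists_mem_ne_zero_of_ne_bot hbot
  obtain ⟨d', hd'⟩ := Ideal.mem_span_singleton'.1 (Ideal.mem_comap.1 hm)
  have hJ₀ : J₀ ≠ 0 := by
    rintro rfl
    exact J.ne_zero (by rw [hJ]; simp)
  have hd0 : d' ≠ 0 := by
    rintro rfl
    rw [zero_mul, eq_comm, map_eq_zero_iff _ (FaithfulSMul.algebraMap_injective _ _)] at hd'
    exact hm0 hd'
  refine ⟨Units.mk0 (m : k) (RingOfIntegers.coe_ne_zero_iff.2 hm0), ⟨Ideal.span {d'} * J₀,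
    mem_nonZeroDivisors_iff_ne_zero.2 (mul_ne_zero ?_ hJ₀)⟩, ?_⟩
  · exact fun h => hd0 (Ideal.span_singleton_eq_bot.1 h)
  · ext1
    rw [Units.val_mul, coe_toPrincipalIdeal, FractionalIdeal.coe_mk0, hJ, ← mul_assoc,
      FractionalIdeal.spanSingleton_mul_spanSingleton, FractionalIdeal.coeIdeal_mul,
      FractionalIdeal.coeIdeal_span_singleton]
    congr 2
    have h1 : algebraMap k L (m : k) = (d' : L) * d := by
      rw [← map_mul, hd']
      rfl
    change algebraMap k L (m : k) * (d : L)⁻¹ = d'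
    rw [h1, mul_inv_cancel_right₀ (RingOfIntegers.coe_ne_zero_iff.2 hd)]

theorem mk0_injective : Function.Injective (FractionalIdeal.mk0 L : (Ideal (𝓞 L))⁰ → FracIdeals L) := by
  intro I J h
  have := congrArg Units.val h
  exact Subtype.ext (FractionalIdeal.coeIdeal_injective this)

/-- In a cyclic extension that is unramified at the finite places, the fractional ideals fixed by a
generator of the Galois group are extended from the base. -/
theorem exists_extFracIdeals_eq [IsGalois k L] (hunr : UnramifiedAtFinitePlaces k L)
    {σ : Gal(L/k)} (hσ : ∀ g, g ∈ Subgroup.zpowers σ) {J : FracIdeals L} (hJ : σ • J = J) :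
    ∃ I, extFracIdeals k L I = J := by
  have hall : ∀ g : Gal(L/k), g • J = J := fun g =>
    (Subgroup.zpowers_le.2 (MulAction.mem_stabilizer_iff.2 hJ) : _ ≤ MulAction.stabilizer _ J) (hσ g)
  obtain ⟨m, J₀, hm⟩ := exists_toPrincipalIdeal_mul_eq_mk0 (k := k) J
  have hinv : ∀ g : Gal(L/k), g • (J₀ : Ideal (𝓞 L)) = J₀ := by
    intro g
    have h := smul_mk0 g J₀
    rw [← hm, smul_mul', hall, ← extFracIdeals_toPrincipalIdeal, smul_extFracIdeals,
      extFracIdeals_toPrincipalIdeal, hm] at h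
    exact (congrArg Subtype.val (mk0_injective h)).symm
  obtain ⟨I, hI⟩ := exists_map_eq_of_forall_smul_eq hunr J₀.1
    (mem_nonZeroDivisors_iff_ne_zero.1 J₀.2) hinv
  have hI0 : I ≠ 0 := by
    rintro rfl
    refine mem_nonZeroDivisors_iff_ne_zero.1 J₀.2 ?_
    rw [← hI]
    exact Ideal.map_bot
  refine ⟨(toPrincipalIdeal (𝓞 k) k m)⁻¹ *
    FractionalIdeal.mk0 k ⟨I, mem_nonZeroDivisors_iff_ne_zero.2 hI0⟩, ?_⟩
  rw [map_mul, map_inv, extFracIdeals_toPrincipalIdeal, extFracIdeals_mk0, inv_mul_eq_iff_eq_mul, hm]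
  exact congrArg _ (Subtype.ext hI)

theorem mem_cap_iff {I : FracIdeals k} :
    ClassGroup.mk k I ∈ Cap k L ↔ ∃ x, toPrincipalIdeal (𝓞 L) L x = extFracIdeals k L I := by
  rw [Cap, MonoidHom.mem_ker, ← mk_extFracIdeals, mk_eq_one_iff_exists_toPrincipalIdeal_eq]

omit [NumberField k] [NumberField L] in
/-- **Hilbert's Theorem 90** for the units of a cyclic extension of fields. -/
theorem exists_divSMulHom_eq_of_prodSMulHom_eq_one [FiniteDimensional k L]
    [Fintype Gal(L/k)] {σ : Gal(L/k)} (hσ : ∀ g, g ∈ Subgroup.zpowers σ) {x : Lˣ}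
    (hx : prodSMulHom Gal(L/k) Lˣ x = 1) : ∃ y, divSMulHom Lˣ σ y = x := by
  have hfin : IsOfFinOrder σ := isOfFinOrder_of_finite σ
  set n := orderOf σ with hn
  have hnpos : 0 < n := hfin.orderOf_pos
  have hinj : Function.Injective fun i : Fin n => σ ^ (i : ℕ) := fun i j hij =>
    Fin.ext (pow_injOn_Iio_orderOf i.2 j.2 hij)
  have hsurj : Function.Surjective fun i : Fin n => σ ^ (i : ℕ) := by
    intro g
    obtain ⟨i, hi⟩ := (hfin.mem_powers_iff_mem_zpowers.2 (hσ g) : g ∈ Submonoid.powers σ)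
    exact ⟨⟨i % n, Nat.mod_lt _ hnpos⟩, (pow_mod_orderOf σ i).trans hi⟩
  -- Partial norms of x. By `hcs` and c n = c 0 = 1, a resolvent y = ∑ c i · σ^i z satisfies x · σ y
  -- = y; Dedekind independence lets z be chosen with y ≠ 0.
  let c : ℕ → Lˣ := fun i => ∏ j ∈ Finset.range i, σ ^ j • x
  have hc0 : c 0 = 1 := Finset.prod_range_zero _
  have hcn : c n = 1 := by
    rw [← hx, prodSMulHom_apply]
    simp only [c]
    rw [Finset.prod_range]
    exact Fintype.prod_bijective _ ⟨hinj, hsurj⟩ _ _ fun i => rfl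
  have hcs : ∀ i, x * σ • c i = c (i + 1) := by
    intro i
    simp only [c]
    rw [Finset.prod_range_succ', Finset.smul_prod', pow_zero, one_smul, mul_comm]
    congr 1
    refine Finset.prod_congr rfl fun j _ => ?_
    rw [pow_succ', mul_smul]
  have hli : LinearIndependent L fun i : Fin n => (((σ ^ (i : ℕ) : Gal(L/k)) : L →* L) : L → L) := by
    refine (linearIndependent_monoidHom L L).comp
      (fun i : Fin n => ((σ ^ (i : ℕ) : Gal(L/k)) : L →* L)) fun i j hij => hinj ?_
    ext z
    exact DFunLike.congr_fun hij z
  obtain ⟨z, hz⟩ : ∃ z : L, ∑ i ∈ Finset.range n, (c i : L) * (σ ^ i) z ≠ 0 := by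
    by_contra! h
    have h0 := Fintype.linearIndependent_iff.1 hli (fun i => (c i : L)) (by
      funext z
      rw [Finset.sum_apply]
      have := h z
      rw [Finset.sum_range] at this
      exact this) ⟨0, hnpos⟩
    exact (c 0).ne_zero h0
  set y := ∑ i ∈ Finset.range n, (c i : L) * (σ ^ i) z with hy
  have hxy : (x : L) * σ y = y := by
    have h1 : (x : L) * σ y = ∑ i ∈ Finset.range n, (c (i + 1) : L) * (σ ^ (i + 1)) z := by
      rw [hy, map_sum, Finset.mul_sum]
      refine Finset.sum_congr rfl fun i _ => ?_
      rw [map_mul, ← mul_assoc, ← hcs, pow_succ']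
      rfl
    have h2 := Finset.sum_range_succ (fun i => (c i : L) * (σ ^ i) z) n
    have h3 := Finset.sum_range_succ' (fun i => (c i : L) * (σ ^ i) z) n
    rw [h3, hcn, hc0, hn, pow_orderOf_eq_one, pow_zero, add_left_inj] at h2
    rw [h1, hy, ← hn] at *
    exact h2
  refine ⟨Units.mk0 y hz, ?_⟩
  rw [divSMulHom_apply, div_eq_iff_eq_mul]
  ext
  exact hxy.symm

/-- The first cohomology of the units injects into the capitulation group. -/
theorem relIndex_divSMulHom_dvd_card_cap [IsGalois k L] [FiniteDimensional k L]
    [Fintype Gal(L/k)] (hunr : UnramifiedAtFinitePlaces k L)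
    {σ : Gal(L/k)} (hσ : ∀ g, g ∈ Subgroup.zpowers σ) :
    ((integralUnits L).map (divSMulHom Lˣ σ)).relIndex
        (integralUnits L ⊓ (prodSMulHom Gal(L/k) Lˣ).ker) ∣ Nat.card (Cap k L) := by
  -- Pairs (a, I) with (a) = I𝓞_L. The map a/σa hits every unit of norm 1, by Theorem 90 and descent
  -- of fixed ideals, while [I] lies in the capitulation group. If [I] = 1, then a is a unit times
  -- an element of k, so a/σa comes from a unit.
  let Y : Subgroup (Lˣ × FracIdeals k) :=
    ((toPrincipalIdeal (𝓞 L) L).comp (MonoidHom.fst _ _)).eqLocus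
      ((extFracIdeals k L).comp (MonoidHom.snd _ _))
  have hY : ∀ y : Y, toPrincipalIdeal (𝓞 L) L y.1.1 = extFracIdeals k L y.1.2 := fun y => y.2
  let f : Y →* Lˣ := ((divSMulHom Lˣ σ).comp (MonoidHom.fst _ _)).comp Y.subtype
  let c : Y →* ClassGroup (𝓞 k) := ((ClassGroup.mk k).comp (MonoidHom.snd _ _)).comp Y.subtype
  have hf : f.range = integralUnits L ⊓ (prodSMulHom Gal(L/k) Lˣ).ker := by
    ext u
    constructor
    · rintro ⟨y, rfl⟩
      refine ⟨?_, prodSMulHom_divSMulHom σ _⟩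
      refine toPrincipalIdeal_eq_one_iff_mem_integralUnits.1 ?_
      change toPrincipalIdeal (𝓞 L) L (y.1.1 / σ • y.1.1) = 1
      rw [map_div, ← smul_toPrincipalIdeal, hY, smul_extFracIdeals, div_self']
    · rintro ⟨hu, hn⟩
      obtain ⟨a, rfl⟩ := exists_divSMulHom_eq_of_prodSMulHom_eq_one hσ hn
      have h := toPrincipalIdeal_eq_one_iff_mem_integralUnits.2 hu
      rw [divSMulHom_apply, map_div, ← smul_toPrincipalIdeal, div_eq_one] at h
      obtain ⟨I, hI⟩ := exists_extFracIdeals_eq hunr hσ h.symm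
      exact ⟨⟨(a, I), hI.symm⟩, rfl⟩
  have hc : c.range ≤ Cap k L := by
    rintro _ ⟨y, rfl⟩
    exact mem_cap_iff.2 ⟨_, hY y⟩
  have hle : c.ker ≤ ((integralUnits L).map (divSMulHom Lˣ σ)).comap f := by
    intro y hy
    obtain ⟨b, hb⟩ := mk_eq_one_iff_exists_toPrincipalIdeal_eq.1 (MonoidHom.mem_ker.1 hy)
    change toPrincipalIdeal (𝓞 k) k b = y.1.2 at hb
    set b' := Units.map (algebraMap k L).toMonoidHom b with hb'
    have h1 : toPrincipalIdeal (𝓞 L) L (y.1.1 / b') = 1 := by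
      rw [map_div, hY, ← hb, extFracIdeals_toPrincipalIdeal, div_self']
    refine ⟨_, toPrincipalIdeal_eq_one_iff_mem_integralUnits.1 h1, ?_⟩
    have h2 : divSMulHom Lˣ σ b' = 1 := by
      rw [divSMulHom_apply, div_eq_one]
      ext
      exact (σ.commutes _).symm
    rw [map_div, h2, div_one]
    rfl
  rw [← hf, ← Subgroup.index_comap]
  refine (Subgroup.index_dvd_of_le hle).trans ?_
  rw [Subgroup.index_ker]
  exact Subgroup.card_dvd_of_le hc

/-- **Hilbert's Theorem 94**, in the form that records the norm index of the units. -/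
theorem card_mul_relIndex_prodSMulHom_dvd_card_cap [IsGalois k L] [FiniteDimensional k L]
    [Fintype Gal(L/k)] [IsUnramifiedAtInfinitePlaces k L] (hunr : UnramifiedAtFinitePlaces k L)
    {σ : Gal(L/k)} (hσ : ∀ g, g ∈ Subgroup.zpowers σ) :
    Fintype.card Gal(L/k) * ((integralUnits L).map (prodSMulHom Gal(L/k) Lˣ)).relIndex
        (integralUnits L ⊓ (divSMulHom Lˣ σ).ker) ∣ Nat.card (Cap k L) := by
  rw [← relIndex_divSMulHom_integralUnits hσ]
  exact relIndex_divSMulHom_dvd_card_cap hunr hσ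

end Capitulation

/-! ### Capitulation in a tower k ⊆ L ⊆ K. -/

section Tower

open NumberField nonZeroDivisors

variable {k L K : Type*} [Field k] [NumberField k] [Field L] [NumberField L] [Algebra k L]
  [Field K] [NumberField K] [Algebra k K] [Algebra L K] [IsScalarTower k L K]

/-- The action of the Galois group on the ideal class group. -/
noncomputable def galClassGroup (g : Gal(L/k)) : ClassGroup (𝓞 L) →* ClassGroup (𝓞 L) :=
  (ClassGroup.mk L).liftOfSurjective mk_surjective
    ⟨(ClassGroup.mk L).comp (galFracIdeals g), fun I hI => by
      obtain ⟨x, rfl⟩ := mk_eq_one_iff_exists_toPrincipalIdeal_eq.1 (MonoidHom.mem_ker.1 hI)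
      rw [MonoidHom.mem_ker, MonoidHom.comp_apply, galFracIdeals_toPrincipalIdeal,
        mk_toPrincipalIdeal]⟩

theorem galClassGroup_mk (g : Gal(L/k)) (I : FracIdeals L) :
    galClassGroup g (ClassGroup.mk L I) = ClassGroup.mk L (g • I) :=
  MonoidHom.liftOfRightInverse_comp_apply _ _ _ _ I

theorem galClassGroup_iterate (g : Gal(L/k)) (n : ℕ) (I : FracIdeals L) :
    (galClassGroup g)^[n] (ClassGroup.mk L I) = ClassGroup.mk L (g ^ n • I) := by
  induction n with
  | zero => rw [pow_zero, one_smul]; rfl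
  | succ n ih => rw [Function.iterate_succ_apply', ih, galClassGroup_mk, pow_succ', mul_smul]

/-- Lift g to h in Gal(K/k): if I becomes (x) in K, then g • I becomes (h • x). -/
theorem galClassGroup_mem_cap [IsGalois k K] [Normal k L] (g : Gal(L/k)) {c : ClassGroup (𝓞 L)}
    (hc : c ∈ Cap L K) : galClassGroup g c ∈ Cap L K := by
  obtain ⟨I, rfl⟩ := mk_surjective c
  obtain ⟨x, hx⟩ := mem_cap_iff.1 hc
  obtain ⟨h, hh⟩ := AlgEquiv.restrictNormalHom_surjective (F := k) (K₁ := L) K g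
  rw [galClassGroup_mk, mem_cap_iff]
  refine ⟨h • x, ?_⟩
  rw [← smul_toPrincipalIdeal, hx, extFracIdeals_smul g h fun y => ?_]
  rw [← hh]
  exact (AlgEquiv.restrictNormal_commutes h L y).symm

variable (K) in
/-- The classes fixed by `σ` that capitulate in `K`. -/
noncomputable def fixedCap (σ : Gal(L/k)) : Subgroup (ClassGroup (𝓞 L)) :=
  Cap L K ⊓ (galClassGroup σ).eqLocus (MonoidHom.id _)

/-- The p^m-th power of the action of σ on Cap(K/L) is trivial, so the number of fixed points is
congruent to the order modulo p. -/
theorem prime_dvd_card_fixedCap [IsGalois k K] [Normal k L] {p m : ℕ} [Fact p.Prime]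
    {σ : Gal(L/k)} (hσ : σ ^ p ^ m = 1) (hdvd : p ∣ Nat.card (Cap L K)) :
    p ∣ Nat.card (fixedCap K σ) := by
  classical
  let f : Function.End (Cap L K) := fun c => ⟨galClassGroup σ c, galClassGroup_mem_cap σ c.2⟩
  have hval : ∀ (n : ℕ) (c : Cap L K), ((f ^ n) c : ClassGroup (𝓞 L)) =
      (galClassGroup σ)^[n] (c : ClassGroup (𝓞 L)) := by
    intro n
    induction n with
    | zero => intro c; rfl
    | succ n ih =>
      intro c
      rw [Function.iterate_succ_apply', ← ih, pow_succ']
      rfl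
  have hf : f ^ p ^ m = 1 := by
    funext c
    apply Subtype.ext
    rw [hval]
    obtain ⟨I, hI⟩ := mk_surjective (c : ClassGroup (𝓞 L))
    rw [← hI, galClassGroup_iterate, hσ, one_smul, hI]
    rfl
  have : Fintype (Cap L K) := Fintype.ofFinite _
  have h := Equiv.Perm.card_fixedPoints_modEq hf
  have e : Fintype.card f.fixedPoints = Nat.card (fixedCap K σ) := by
    rw [← Nat.card_eq_fintype_card]
    refine Nat.card_congr ⟨fun c => ⟨c.1.1, c.1.2, congrArg Subtype.val c.2⟩,
      fun c => ⟨⟨c.1, c.2.1⟩, Subtype.ext c.2.2⟩, fun c => rfl, fun c => rfl⟩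
  rw [e, ← Nat.card_eq_fintype_card] at h
  exact (Nat.modEq_zero_iff_dvd).1 (h.symm.trans ((Nat.modEq_zero_iff_dvd).2 hdvd))

theorem toPrincipalIdeal_prodSMulHom [Fintype Gal(L/k)] (x : Lˣ) :
    toPrincipalIdeal (𝓞 L) L (prodSMulHom Gal(L/k) Lˣ x) =
      prodSMulHom Gal(L/k) (FracIdeals L) (toPrincipalIdeal (𝓞 L) L x) := by
  rw [prodSMulHom_apply, prodSMulHom_apply, map_prod]
  exact Finset.prod_congr rfl fun g _ => (smul_toPrincipalIdeal g x).symm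

theorem toPrincipalIdeal_divSMulHom (σ : Gal(L/k)) (x : Lˣ) :
    toPrincipalIdeal (𝓞 L) L (divSMulHom Lˣ σ x) =
      divSMulHom (FracIdeals L) σ (toPrincipalIdeal (𝓞 L) L x) := by
  rw [divSMulHom_apply, divSMulHom_apply, map_div, smul_toPrincipalIdeal]

omit [Algebra k K] [IsScalarTower k L K] in
/-- The fixed classes that capitulate in `K` come from the base, up to the norm index of units. -/
theorem card_fixedCap_dvd [IsGalois k L] [FiniteDimensional k L] [Fintype Gal(L/k)]
    (hunr : UnramifiedAtFinitePlaces k L) {σ : Gal(L/k)} (hσ : ∀ g, g ∈ Subgroup.zpowers σ) :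
    Nat.card (fixedCap K σ) ∣
      Nat.card (Cap L K ⊓ (ClassGroup.extendedHom (𝓞 k) (𝓞 L)).range : Subgroup _) *
      ((integralUnits L).map (prodSMulHom Gal(L/k) Lˣ)).relIndex
        (integralUnits L ⊓ (divSMulHom Lˣ σ).ker) := by
  set B : Subgroup (ClassGroup (𝓞 L)) :=
    Cap L K ⊓ (ClassGroup.extendedHom (𝓞 k) (𝓞 L)).range with hB
  -- Pairs (a, J) with (a) = J/σJ and [J] in Cap(K/L): then [J] runs through the fixed classes and
  -- N(a) is a unit fixed by σ. If N(a) = N(u) for a unit u, Theorem 90 gives a/u = b/σb, so J/(b)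
  -- is fixed, hence extended from k, and [J] lies in `B`.
  let Y : Subgroup (Lˣ × FracIdeals L) :=
    ((toPrincipalIdeal (𝓞 L) L).comp (MonoidHom.fst _ _)).eqLocus
      ((divSMulHom (FracIdeals L) σ).comp (MonoidHom.snd _ _)) ⊓
    (Cap L K).comap ((ClassGroup.mk L).comp (MonoidHom.snd _ _))
  have hY : ∀ y : Y, toPrincipalIdeal (𝓞 L) L y.1.1 = divSMulHom (FracIdeals L) σ y.1.2 :=
    fun y => y.2.1
  let f : Y →* Lˣ := ((prodSMulHom Gal(L/k) Lˣ).comp (MonoidHom.fst _ _)).comp Y.subtype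
  let c : Y →* ClassGroup (𝓞 L) := ((ClassGroup.mk L).comp (MonoidHom.snd _ _)).comp Y.subtype
  have hc : c.range = fixedCap K σ := by
    ext x
    constructor
    · rintro ⟨y, rfl⟩
      refine ⟨y.2.2, ?_⟩
      change galClassGroup σ (ClassGroup.mk L y.1.2) = ClassGroup.mk L y.1.2
      rw [galClassGroup_mk, eq_comm, ← div_eq_one, ← map_div]
      exact mk_eq_one_iff_exists_toPrincipalIdeal_eq.2 ⟨_, hY y⟩
    · rintro ⟨hx, hfix⟩
      obtain ⟨J, rfl⟩ := mk_surjective x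
      change galClassGroup σ (ClassGroup.mk L J) = ClassGroup.mk L J at hfix
      rw [galClassGroup_mk, eq_comm, ← div_eq_one, ← map_div] at hfix
      obtain ⟨a, ha⟩ := mk_eq_one_iff_exists_toPrincipalIdeal_eq.1 hfix
      exact ⟨⟨(a, J), ha, hx⟩, rfl⟩
  have hf : f.range ≤ integralUnits L ⊓ (divSMulHom Lˣ σ).ker := by
    rintro _ ⟨y, rfl⟩
    refine ⟨toPrincipalIdeal_eq_one_iff_mem_integralUnits.1 ?_, divSMulHom_prodSMulHom σ _⟩
    change toPrincipalIdeal (𝓞 L) L (prodSMulHom Gal(L/k) Lˣ y.1.1) = 1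
    rw [toPrincipalIdeal_prodSMulHom, hY, prodSMulHom_divSMulHom]
  have hNf : (integralUnits L).map (prodSMulHom Gal(L/k) Lˣ) ≤ f.range := by
    rintro _ ⟨u, hu, rfl⟩
    refine ⟨⟨(u, 1), ?_, ?_⟩, rfl⟩
    · change toPrincipalIdeal (𝓞 L) L u = divSMulHom (FracIdeals L) σ 1
      rw [toPrincipalIdeal_eq_one_iff_mem_integralUnits.2 hu, map_one]
    · exact one_mem ((Cap L K).comap ((ClassGroup.mk L).comp (MonoidHom.snd Lˣ (FracIdeals L))))
  have hle : ((integralUnits L).map (prodSMulHom Gal(L/k) Lˣ)).comap f ≤ B.comap c := by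
    rintro y ⟨u, hu, huy⟩
    change prodSMulHom Gal(L/k) Lˣ u = prodSMulHom Gal(L/k) Lˣ y.1.1 at huy
    obtain ⟨b, hb⟩ := exists_divSMulHom_eq_of_prodSMulHom_eq_one hσ (x := y.1.1 / u)
      (by rw [map_div, huy, div_self'])
    have h1 : divSMulHom (FracIdeals L) σ (y.1.2 / toPrincipalIdeal (𝓞 L) L b) = 1 := by
      rw [map_div, ← toPrincipalIdeal_divSMulHom, hb, map_div,
        toPrincipalIdeal_eq_one_iff_mem_integralUnits.2 hu, div_one, hY, div_self']
    obtain ⟨I, hI⟩ := exists_extFracIdeals_eq hunr hσ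
      (mem_ker_divSMulHom.1 (MonoidHom.mem_ker.2 h1))
    refine ⟨y.2.2, ClassGroup.mk k I, ?_⟩
    rw [← mk_extFracIdeals, hI, map_div, mk_toPrincipalIdeal, div_one]
    rfl
  have h1 := Subgroup.index_dvd_of_le hle
  rw [Subgroup.index_comap, Subgroup.index_comap, hc] at h1
  have h2 : ((integralUnits L).map (prodSMulHom Gal(L/k) Lˣ)).relIndex f.range ∣ _ :=
    Dvd.intro _ (Subgroup.relIndex_mul_relIndex _ _ _ hNf hf)
  have h3 : Nat.card (B ⊓ fixedCap K σ : Subgroup _) * B.relIndex (fixedCap K σ) =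
      Nat.card (fixedCap K σ) := by
    rw [← Subgroup.inf_relIndex_right, ← Subgroup.relIndex_bot_left, ← Subgroup.relIndex_bot_left]
    exact Subgroup.relIndex_mul_relIndex _ _ _ bot_le inf_le_right
  rw [← h3]
  exact mul_dvd_mul (Subgroup.card_dvd_of_le inf_le_left) (h1.trans h2)

variable (k L K) in
theorem cap_eq_comap : Cap k K = (Cap L K).comap (ClassGroup.extendedHom (𝓞 k) (𝓞 L)) := by
  rw [Cap, Cap, MonoidHom.comap_ker, ClassGroup.extendedHom_comp]

variable (k L K) in
-- Kernel of the composite Cl_k → Cl_L → Cl_K: its image in Cl_L is the part of Cap(K/L) coming from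
-- Cl_k, with kernel Cap(L/k).
theorem card_cap_eq_mul : Nat.card (Cap k K) = Nat.card (Cap k L) *
    Nat.card (Cap L K ⊓ (ClassGroup.extendedHom (𝓞 k) (𝓞 L)).range : Subgroup _) := by
  have hle : Cap k L ≤ Cap k K := by
    rw [cap_eq_comap k L K, Cap, ← MonoidHom.comap_bot]
    exact Subgroup.comap_mono bot_le
  have h : (Cap L K ⊓ (ClassGroup.extendedHom (𝓞 k) (𝓞 L)).range : Subgroup _) =
      (Cap k K).map (ClassGroup.extendedHom (𝓞 k) (𝓞 L)) := by
    rw [cap_eq_comap k L K, Subgroup.map_comap_eq, inf_comm]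
  rw [h, ← Subgroup.relIndex_ker, ← Subgroup.relIndex_bot_left, ← Subgroup.relIndex_bot_left]
  exact (Subgroup.relIndex_mul_relIndex _ _ _ bot_le hle).symm

variable (k L K) in
theorem card_cap_dvd_card_cap : Nat.card (Cap k L) ∣ Nat.card (Cap k K) :=
  ⟨_, card_cap_eq_mul k L K⟩

theorem UnramifiedAtFinitePlaces.bot (h : UnramifiedAtFinitePlaces k K) :
    UnramifiedAtFinitePlaces k L := by
  intro p hp hp0
  obtain ⟨P, hP, hPp⟩ := (inferInstance : Nonempty (p.primesOver (𝓞 K)))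
  have := h P (Ideal.ne_bot_of_liesOver_of_ne_bot hp0 P)
  exact Algebra.IsUnramifiedAt.of_liesOver (𝓞 k) p P

theorem UnramifiedAtFinitePlaces.top (h : UnramifiedAtFinitePlaces k K) :
    UnramifiedAtFinitePlaces L K := by
  intro P hP hP0
  have := h P hP0
  exact Algebra.IsUnramifiedAt.of_restrictScalars (𝓞 k) P

/-- The norm index of units occurs as an extra factor in Theorem 94 for L/k and as the error term
for fixed classes; multiplying the two divisibilities absorbs it. -/
theorem finrank_dvd_card_cap_of_tower [IsGalois k L] [IsGalois k K]
    (hunr : UnramifiedAtFinitePlaces k K) [IsUnramifiedAtInfinitePlaces k K]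
    {p m : ℕ} [Fact p.Prime] (hcyc : IsCyclic Gal(L/k)) (hcard : Nat.card Gal(L/k) = p ^ m)
    (hp : Module.finrank L K ∣ p) :
    Module.finrank k K ∣ Nat.card (Cap k K) := by
  classical
  have : FiniteDimensional k L := Module.Finite.of_restrictScalars_finite ℚ k L
  have : FiniteDimensional L K := Module.Finite.of_restrictScalars_finite ℚ L K
  have : IsGalois L K := IsGalois.tower_top_of_isGalois k L K
  have : IsUnramifiedAtInfinitePlaces k L := IsUnramifiedAtInfinitePlaces.bot k L K
  have : IsUnramifiedAtInfinitePlaces L K := IsUnramifiedAtInfinitePlaces.top k L K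
  have : Fintype Gal(L/k) := Fintype.ofFinite _
  have : Fintype Gal(K/L) := Fintype.ofFinite _
  obtain ⟨σ, hσ⟩ := hcyc
  have hA : Module.finrank L K ∣ Nat.card (fixedCap K σ) := by
    rcases (Nat.dvd_prime Fact.out).1 hp with h1 | h1
    · rw [h1]; exact one_dvd _
    · rw [h1]
      refine prime_dvd_card_fixedCap (m := m) ?_ ?_
      · rw [← hcard]; exact pow_card_eq_one'
      · have hc : Nat.card Gal(K/L) = p := by rw [IsGalois.card_aut_eq_finrank, h1]
        obtain ⟨τ, hτ⟩ := isCyclic_of_prime_card hc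
        have := card_mul_relIndex_prodSMulHom_dvd_card_cap (hunr.top (L := L)) hτ
        rw [← Nat.card_eq_fintype_card, hc] at this
        exact (dvd_mul_right _ _).trans this
  have hL := card_mul_relIndex_prodSMulHom_dvd_card_cap (hunr.bot (L := L)) hσ
  have hB := hA.trans (card_fixedCap_dvd (K := K) (hunr.bot (L := L)) hσ)
  rw [← Nat.card_eq_fintype_card, IsGalois.card_aut_eq_finrank] at hL
  rw [card_cap_eq_mul k L K, ← Module.finrank_mul_finrank k L K]
  refine (mul_dvd_mul_left _ hB).trans ?_
  rw [mul_comm (Nat.card (Cap L K ⊓ _ : Subgroup _)), ← mul_assoc]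
  exact mul_dvd_mul_right hL _

end Tower

/-! ### Reduction to p-groups and conclusion. -/

/-- The image T of E is a p-group of squarefree order, so |T| divides p, and modulo T only the
cyclic image of C remains. A surjection π suffices, and it is what survives passage to a quotient of
C × E. -/
theorem finrank_dvd_card_cap_of_isPGroup {k K : Type*} [Field k] [NumberField k] [Field K]
    [NumberField K] [Algebra k K] [IsGalois k K]
    (hunr : UnramifiedAtFinitePlaces k K) [IsUnramifiedAtInfinitePlaces k K]
    {p : ℕ} [Fact p.Prime] (hG : IsPGroup p Gal(K/k)) {C E : Type*} [Group C] [Group E]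
    (hC : IsCyclic C) (hE : Squarefree (Nat.card E)) (π : C × E →* Gal(K/k))
    (hπ : Function.Surjective π) : Module.finrank k K ∣ Nat.card (Cap k K) := by
  have : FiniteDimensional k K := Module.Finite.of_restrictScalars_finite ℚ k K
  let T : Subgroup Gal(K/k) := (π.comp (MonoidHom.inr C E)).range
  have hTn : T.Normal := by
    have : T = (MonoidHom.inr C E).range.map π := MonoidHom.range_comp _ _
    rw [this]
    refine Subgroup.Normal.map ?_ π hπ
    have h : (MonoidHom.inr C E).range = (MonoidHom.fst C E).ker := by
      ext x
      constructor
      · rintro ⟨y, rfl⟩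
        rfl
      · intro hx
        exact ⟨x.2, Prod.ext (MonoidHom.mem_ker.1 hx).symm rfl⟩
    rw [h]
    infer_instance
  let L := IntermediateField.fixedField T
  have hLG : IsGalois k L := IsGalois.of_fixedField_normal_subgroup T
  have hcyc : IsCyclic Gal(L/k) := by
    let φ : C →* Gal(L/k) :=
      (AlgEquiv.restrictNormalHom L).comp (π.comp (MonoidHom.inl C E))
    refine isCyclic_of_surjective φ fun g => ?_
    obtain ⟨h, rfl⟩ := AlgEquiv.restrictNormalHom_surjective (F := k) (K₁ := L) K g
    obtain ⟨⟨c, x⟩, rfl⟩ := hπ h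
    refine ⟨c, ?_⟩
    have h1 : AlgEquiv.restrictNormalHom L (π (1, x)) = 1 := by
      rw [← MonoidHom.mem_ker, IntermediateField.restrictNormalHom_ker,
        IntermediateField.fixingSubgroup_fixedField]
      exact ⟨x, rfl⟩
    have h2 : ((c, x) : C × E) = (c, 1) * (1, x) := by simp
    rw [h2, map_mul, map_mul, h1, mul_one]
    rfl
  obtain ⟨m, hm⟩ := IsPGroup.iff_card.1
    (hG.of_surjective _ (AlgEquiv.restrictNormalHom_surjective (F := k) (K₁ := L) K))
  refine finrank_dvd_card_cap_of_tower (L := L) (p := p) hunr hcyc hm ?_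
  have hT : Module.finrank L K = Nat.card T := IntermediateField.finrank_fixedField_eq_card T
  obtain ⟨i, hi⟩ := IsPGroup.iff_card.1 (hG.to_subgroup T)
  have hsq : Squarefree (Nat.card T) := hE.squarefree_of_dvd (Subgroup.card_range_dvd _)
  rw [hT]
  rcases eq_or_ne i 0 with rfl | hi0
  · rw [hi, pow_zero]
    exact one_dvd _
  · exact (hsq.dvd_pow_iff_dvd hi0).1 hi.dvd

theorem proposition5 (k K : Type*) [Field k] [NumberField k] [Field K] [NumberField K]
    [Algebra k K] [IsAbelianGalois k K]
    (hfin : UnramifiedAtFinitePlaces k K) (hinf : IsUnramifiedAtInfinitePlaces k K)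
    (C E : Type*) [Group C] [Group E] (hC : IsCyclic C) (hE : IsElementaryCyclic E)
    (e : Gal(K/k) ≃* C × E) :
    Module.finrank k K ∣ Nat.card (Cap k K) := by
  have : FiniteDimensional k K := Module.Finite.of_restrictScalars_finite ℚ k K
  have hcardG : Nat.card Gal(K/k) = Module.finrank k K := IsGalois.card_aut_eq_finrank k K
  have hN : Module.finrank k K ≠ 0 := Module.finrank_pos.ne'
  rw [Nat.dvd_iff_prime_pow_dvd_dvd]
  intro p j hp hj
  have hpF : Fact p.Prime := ⟨hp⟩
  let a := (Module.finrank k K).factorization p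
  let hcomm : CommGroup Gal(K/k) := IsMulCommutative.instCommGroup
  -- With p^a the exact p-part of the order, H is the prime-to-p part: an element x^(p^a) of order p
  -- would give x order p^(a+1). The quotient by H is killed by p^a, so the fixed field of H is the
  -- maximal p-subextension.
  let H : Subgroup Gal(K/k) := (powMonoidHom (p ^ a)).range
  have hcop : (Nat.card H).Coprime p := by
    rw [Nat.coprime_comm, hp.coprime_iff_not_dvd]
    intro hdvd
    obtain ⟨⟨_, x, rfl⟩, hx⟩ := exists_prime_orderOf_dvd_card' p hdvd
    rw [← Subgroup.orderOf_coe] at hx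
    change orderOf (x ^ p ^ a) = p at hx
    have h1 : orderOf x = p ^ (a + 1) := by
      refine orderOf_eq_prime_pow (fun h => ?_) ?_
      · rw [h, orderOf_one] at hx
        exact hp.one_lt.ne hx
      · rw [pow_succ, pow_mul]
        nth_rewrite 2 [← hx]
        exact pow_orderOf_eq_one _
    have h2 : p ^ (a + 1) ∣ Module.finrank k K := by
      rw [← h1, ← hcardG]
      exact orderOf_dvd_natCard x
    exact Nat.pow_succ_factorization_not_dvd hN hp h2
  let L := IntermediateField.fixedField H
  have hLG : IsGalois k L := IsGalois.of_fixedField_normal_subgroup H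
  have hmul : Module.finrank k L * Nat.card H = Module.finrank k K := by
    rw [← IntermediateField.finrank_fixedField_eq_card H]
    exact Module.finrank_mul_finrank k L K
  have hjL : p ^ j ∣ Module.finrank k L := by
    rw [← hmul] at hj
    exact (Nat.Coprime.pow_left j hcop.symm).dvd_of_dvd_mul_right hj
  have hres := AlgEquiv.restrictNormalHom_surjective (F := k) (K₁ := L) K
  have hP : IsPGroup p Gal(L/k) := by
    intro g
    obtain ⟨h, rfl⟩ := hres g
    refine ⟨a, ?_⟩
    rw [← map_pow, ← MonoidHom.mem_ker, IntermediateField.restrictNormalHom_ker,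
      IntermediateField.fixingSubgroup_fixedField]
    exact ⟨h, rfl⟩
  have hinfL : IsUnramifiedAtInfinitePlaces k L := IsUnramifiedAtInfinitePlaces.bot k L K
  have key := finrank_dvd_card_cap_of_isPGroup (hfin.bot (L := L)) hP hC hE.squarefree_card
    ((AlgEquiv.restrictNormalHom L).comp e.symm.toMonoidHom)
    (hres.comp e.symm.surjective)
  exact hjL.trans (key.trans (card_cap_dvd_card_cap k L K))
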